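/- Let $\mathbb K\in\{\mathbb R,\mathbb C\}$, let $X,Y$ be Banach spaces over $\mathbb K$, let $S\colon X\to Y$ be a continuous linear operator and $F\subset X$ convex and bounded. *Algorithms.* A deterministic algorithm with $n\in\mathbb N_0$ measurements is a mapping $A=\varphi\circ N\colon F\to Y$ with an arbitrary mapping $\varphi\colon\mathbb K^n\to Y$ and an information mapping $N=N_n$, $N_k(f)=(N_{k-1}(f),L_k(f))$, where the continuous linear functional $L_k\in X'$ may depend on $N_{k-1}(f)$ (adaptive choice). The algorithm is non-adaptive if $N=(L_1,\dots,L_n)$ with fixed $L_1,\dots,L_n\in X'$. Its error is $\sup_{f\in F}\|S(f)-A(f)\|_Y$. A randomized algorithm is a family $(A^\omega)_{\omega\in\Omega}$ of deterministic algorithms with $n$ measurements, indexed by a probability space $(\Omega,\mathcal A,\mathbb P)$, such that $(f,\omega)\mapsto\|S(f)-A^\omega(f)\|_Y$ is $\mathcal B_F\otimes\mathcal A$-measurable, where $\mathcal B_F$ is the Borel $\sigma$-algebra of the topology on $F$ given by the seminorm with unit ball $F-F$ (its Minkowski functional). It is non-adaptive if every $A^\omega$ is. Its error is $\sup_{f\in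 F}\mathbb E\,\|S(f)-A^\omega(f)\|_Y$. For $*\in\{\mathrm{det},\mathrm{det\text{-}non},\mathrm{ran},\mathrm{ran\text{-}non}\}$ let $e_n^*(S,F)$ be the infimum of the errors of all algorithms with $n$ measurements that are deterministic (det), deterministic and non-adaptive (det-non), randomized (ran), or randomized and non-adaptive (ran-non), respectively. *Claim.* There is a universal constant $C$ such that for all $X,Y,S,F$ as above, all $*,\square\in\{\mathrm{det},\mathrm{det\text{-}non},\mathrm{ran},\mathrm{ran\text{-}non}\}$ and all integers $n\ge1$, $$e_{2n-1}^*(S,F)\;\le\;C\,n^{3/2}\,\Big(\prod_{k<n}e_k^\square(S,F)\Big)^{1/n},$$ where the product is over $k=0,\dots,n-1$. Moreover, the following improvements hold. a) If $F$ is symmetric ($F=-F$), then $n^{3/2}$ can be replaced with $n$. b) If $Y$ is a Hilbert space, then $n^{3/2}$ can be replaced with $n$. c) If $F$ is symmetric and $Y$ is a Hilbert space, then $n^{3/2}$ can be replaced with $n^{1/2}$. d) If $X$ is a Hilbert space and $F=B_X$ is its closed unit ball, then $$e_{4n-1}^*(S,B_X)\;\le\;C\,n^{1/2}\,\Big(\prod_{k<n}e_k^\square(S,B_X)\Big)^{1/n}.$$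 -/

import Mathlib

open MeasureTheory
open scoped ENNReal NNReal Pointwise

universe w a b c

/-- The four classes of algorithms: deterministic or randomized, with adaptively
or non-adaptively chosen measurements. -/
inductive AlgClass
  | det
  | detNon
  | ran
  | ranNon

section Algorithms

variable {𝕜 X Y : Type*} [RCLike 𝕜]
  [NormedAddCommGroup X] [NormedSpace 𝕜 X] [NormedAddCommGroup Y] [NormedSpace 𝕜 Y]

/-- The first `n` measurements `N_n(f) = (N_{n-1}(f), L_n(f, N_{n-1}(f)))` of the input `f`.
The functional used in the next step is `L n y`, where `y` is the vector of the `n` values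
observed so far. -/
def adaptiveInfo (L : (k : ℕ) → (Fin k → 𝕜) → (X →L[𝕜] 𝕜)) (f : X) : (n : ℕ) → (Fin n → 𝕜)
  | 0 => Fin.elim0
  | n + 1 => Fin.snoc (α := fun _ => 𝕜) (adaptiveInfo L f n) (L n (adaptiveInfo L f n) f)

variable (𝕜) in
/-- `A = φ ∘ N` on `F`, with an adaptive information mapping `N` that uses `n` continuous linear
functionals and an arbitrary reconstruction mapping `φ`. -/
def IsAdaptiveAlg (n : ℕ) (F : Set X) (A : F → Y) :
    Prop :=
  ∃ (L : (k : ℕ) → (Fin k → 𝕜) → (X →L[𝕜] 𝕜)) (φ : (Fin n → 𝕜) → Y),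
    ∀ f : F, A f = φ (adaptiveInfo L (f : X) n)

variable (𝕜) in
/-- `A = φ ∘ N` on `F`, with `N = (L_1, …, L_n)` for fixed continuous linear functionals `L_i`
and an arbitrary reconstruction mapping `φ`. -/
def IsNonadaptiveAlg (n : ℕ) (F : Set X) (A : F → Y) :
    Prop :=
  ∃ (L : Fin n → (X →L[𝕜] 𝕜)) (φ : (Fin n → 𝕜) → Y), ∀ f : F, A f = φ (fun i => L i (f : X))

/-- The topology on `F` given by the seminorm with unit ball `F - F` (its Minkowski functional),
generated by the balls around the points of `F`. -/
def classTopology [NormedSpace ℝ X] (F : Set X) : TopologicalSpace F :=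
  TopologicalSpace.generateFrom
    {U | ∃ (f : F) (r : ℝ), U = {g : F | gauge (F - F) ((g : X) - (f : X)) < r}}

/-- The Borel σ-algebra of `classTopology F`. -/
def classBorel [NormedSpace ℝ X] (F : Set X) : MeasurableSpace F :=
  @borel F (classTopology F)

/-- The worst-case error over `F` of a deterministic algorithm. -/
noncomputable def detError (S : X →L[𝕜] Y) (F : Set X) (A : F → Y) : ℝ≥0∞ :=
  ⨆ f : F, ‖S (f : X) - A f‖ₑ

/-- The worst-case expected error over `F` of a randomized algorithm. -/
noncomputable def ranError {Ω : Type*} [MeasurableSpace Ω] (P : Measure Ω)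
    (S : X →L[𝕜] Y) (F : Set X) (A : Ω → F → Y) : ℝ≥0∞ :=
  ⨆ f : F, ∫⁻ ω, ‖S (f : X) - A ω f‖ₑ ∂P

/-- Joint measurability of the error of a randomized algorithm in the input and in the
random element. -/
def HasMeasurableError [NormedSpace ℝ X] {Ω : Type*} [mΩ : MeasurableSpace Ω]
    (S : X →L[𝕜] Y) (F : Set X) (A : Ω → F → Y) : Prop :=
  Measurable[(classBorel F).prod mΩ] (fun p : F × Ω => ‖S (p.1 : X) - A p.2 p.1‖)

/-- The minimal worst-case error over all randomized algorithms whose realizations belong to the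
class `𝒜` of deterministic algorithms. The probability space is arbitrary (in universe `w`). -/
noncomputable def minRanError {𝕜 : Type a} {X : Type b} {Y : Type c} [RCLike 𝕜]
    [NormedAddCommGroup X] [NormedSpace 𝕜 X] [NormedSpace ℝ X]
    [NormedAddCommGroup Y] [NormedSpace 𝕜 Y]
    (S : X →L[𝕜] Y) (F : Set X) (𝒜 : (F → Y) → Prop) : ℝ≥0∞ :=
  ⨅ (Ω : Type w) (_ : MeasurableSpace Ω) (P : Measure Ω) (_ : IsProbabilityMeasure P)
    (A : Ω → F → Y) (_ : ∀ ω, 𝒜 (A ω)) (_ : HasMeasurableError S F A), ranError P S F A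

/-- The `n`-th minimal worst-case error `e_n^*(S,F)`, where `*` is the class of algorithms. -/
noncomputable def minError {𝕜 : Type a} {X : Type b} {Y : Type c} [RCLike 𝕜]
    [NormedAddCommGroup X] [NormedSpace 𝕜 X] [NormedSpace ℝ X]
    [NormedAddCommGroup Y] [NormedSpace 𝕜 Y]
    (cls : AlgClass) (n : ℕ) (S : X →L[𝕜] Y) (F : Set X) : ℝ≥0∞ :=
  match cls with
  | .det => ⨅ (A : F → Y) (_ : IsAdaptiveAlg 𝕜 n F A), detError S F A
  | .detNon => ⨅ (A : F → Y) (_ : IsNonadaptiveAlg 𝕜 n F A), detError S F A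
  | .ran => minRanError.{w} S F (IsAdaptiveAlg 𝕜 n F)
  | .ranNon => minRanError.{w} S F (IsNonadaptiveAlg 𝕜 n F)

/-- The geometric mean `(∏_{k<n} e_k^*(S,F))^{1/n}` of the first `n` minimal errors. -/
noncomputable def geomMeanError {𝕜 : Type a} {X : Type b} {Y : Type c} [RCLike 𝕜]
    [NormedAddCommGroup X] [NormedSpace 𝕜 X] [NormedSpace ℝ X]
    [NormedAddCommGroup Y] [NormedSpace 𝕜 Y]
    (cls : AlgClass) (n : ℕ) (S : X →L[𝕜] Y) (F : Set X) : ℝ≥0∞ :=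
  (∏ k ∈ Finset.range n, minError.{w} cls k S F) ^ (1 / (n : ℝ))

end Algorithms

section Gauss

open Module

/-- A set is resolved up to `τ` by `l` measurements if there is a decision tree of depth `l`,
querying linear functionals, whose leaves have diameter at most `τ`. -/
def Resolved {E : Type*} [NormedAddCommGroup E] [NormedSpace ℝ E] (τ : ℝ) : ℕ → Set E → Prop
  | 0, M => ∀ x ∈ M, ∀ y ∈ M, ‖x - y‖ ≤ τ
  | l + 1, M => ∃ L : E →ₗ[ℝ] ℝ, ∀ t : ℝ, Resolved τ l (M ∩ {x | L x = t})

theorem Resolved.preimage {E E' : Type*} [NormedAddCommGroup E] [NormedSpace ℝ E]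
    [NormedAddCommGroup E'] [NormedSpace ℝ E'] {τ : ℝ} (J : E' →ₗᵢ[ℝ] E) :
    ∀ (l : ℕ) (M : Set E) (p : E), Resolved τ l M → Resolved τ l {x : E' | p + J x ∈ M}
  | 0, M, p, h => fun x hx y hy => by
      have := h _ hx _ hy
      rwa [add_sub_add_left_eq_sub, ← map_sub, J.norm_map] at this
  | l + 1, M, p, ⟨L, hL⟩ => by
      refine ⟨L.comp J.toLinearMap, fun t => ?_⟩
      convert Resolved.preimage J l _ p (hL (L p + t)) using 1
      ext x
      simp

variable {E : Type*} [NormedAddCommGroup E] [InnerProductSpace ℝ E] [FiniteDimensional ℝ E]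
  [MeasurableSpace E] [BorelSpace E]

theorem lintegral_exp_neg_mul_sq_norm {b : ℝ} (hb : 0 < b) :
    ∫⁻ x : E, ENNReal.ofReal (Real.exp (-b * ‖x‖ ^ 2))
      = ENNReal.ofReal ((Real.pi / b) ^ (finrank ℝ E / 2 : ℝ)) := by
  have h := GaussianFourier.integral_rexp_neg_mul_sq_norm (V := E) hb
  have hpos : 0 < (Real.pi / b) ^ (finrank ℝ E / 2 : ℝ) :=
    Real.rpow_pos_of_pos (div_pos Real.pi_pos hb) _
  rw [← h, ofReal_integral_eq_lintegral_ofReal]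
  · by_contra hni
    rw [integral_undef hni] at h
    exact hpos.ne h
  · exact Filter.Eventually.of_forall fun x => (Real.exp_pos _).le

theorem lintegral_exp_neg_half_sq_norm :
    ∫⁻ x : E, ENNReal.ofReal (Real.exp (-‖x‖ ^ 2 / 2))
      = ENNReal.ofReal ((2 * Real.pi) ^ (finrank ℝ E / 2 : ℝ)) := by
  have := lintegral_exp_neg_mul_sq_norm (E := E) (b := 1 / 2) (by norm_num)
  rw [show Real.pi / (1 / 2) = 2 * Real.pi by ring] at this
  rw [← this]
  congr with x
  ring_nf

/-- A set of diameter at most `τ` has small Gaussian mass. -/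
theorem lintegral_exp_le_of_diam_le {τ : ℝ} (hτ : 0 < τ) (M : Set E)
    (hM : MeasurableSet M) (h : ∀ x ∈ M, ∀ y ∈ M, ‖x - y‖ ≤ τ) {r : ℕ} (hr : 0 < r)
    (hE : finrank ℝ E = r) :
    ∫⁻ x in M, ENNReal.ofReal (Real.exp (-‖x‖ ^ 2 / 2))
      ≤ ENNReal.ofReal (Real.exp r * (Real.pi * τ ^ 2 / r) ^ (r / 2 : ℝ)) := by
  rcases M.eq_empty_or_nonempty with rfl | ⟨x₀, hx₀⟩
  · simp
  have hr' : (0 : ℝ) < r := by exact_mod_cast hr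
  calc ∫⁻ x in M, ENNReal.ofReal (Real.exp (-‖x‖ ^ 2 / 2))
      ≤ ∫⁻ x in M, ENNReal.ofReal (Real.exp r) *
          ENNReal.ofReal (Real.exp (-(r / τ ^ 2) * ‖x - x₀‖ ^ 2)) := by
        refine setLIntegral_mono' hM fun x hx => ?_
        rw [← ENNReal.ofReal_mul (Real.exp_pos _).le, ← Real.exp_add]
        refine ENNReal.ofReal_le_ofReal (Real.exp_le_exp.2 ?_)
        have h1 : ‖x - x₀‖ ^ 2 ≤ τ ^ 2 := pow_le_pow_left₀ (norm_nonneg _) (h x hx x₀ hx₀) 2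
        have h2 : r / τ ^ 2 * ‖x - x₀‖ ^ 2 ≤ r := by
          rw [div_mul_eq_mul_div, div_le_iff₀ (by positivity)]
          exact mul_le_mul_of_nonneg_left h1 hr'.le
        have := sq_nonneg ‖x‖
        linarith
    _ ≤ ∫⁻ x, ENNReal.ofReal (Real.exp r) *
          ENNReal.ofReal (Real.exp (-(r / τ ^ 2) * ‖x - x₀‖ ^ 2)) := setLIntegral_le_lintegral _ _
    _ = _ := by
        rw [lintegral_const_mul' _ _ ENNReal.ofReal_ne_top,
          lintegral_sub_right_eq_self
            (fun x : E => ENNReal.ofReal (Real.exp (-(r / τ ^ 2) * ‖x‖ ^ 2))) x₀,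
          lintegral_exp_neg_mul_sq_norm (by positivity), ← ENNReal.ofReal_mul (Real.exp_pos _).le,
          hE, div_div_eq_mul_div]

theorem lintegral_exp_eq_lintegral_orthogonal (K : Submodule ℝ E) {M : Set E}
    (hM : MeasurableSet M) :
    ∫⁻ x in M, ENNReal.ofReal (Real.exp (-‖x‖ ^ 2 / 2))
      = ∫⁻ k : K, ENNReal.ofReal (Real.exp (-‖k‖ ^ 2 / 2)) *
          ∫⁻ y in {y : Kᗮ | (k : E) + y ∈ M}, ENNReal.ofReal (Real.exp (-‖y‖ ^ 2 / 2)) := by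
  have hmp : MeasurePreserving (fun q : K × Kᗮ => (q.1 : E) + q.2) := by
    have h := (K.orthogonalDecomposition.measurePreserving.trans
      (e := K.orthogonalDecomposition.toHomeomorph.toMeasurableEquiv)
      (e' := (MeasurableEquiv.toLp 2 (K × Kᗮ)).symm)
      (WithLp.volume_preserving_ofLp _ _)).symm
    convert h using 1
    ext q
    simp
  have hmeas : Measurable (fun x : E => ENNReal.ofReal (Real.exp (-‖x‖ ^ 2 / 2))) := by fun_prop
  rw [← lintegral_indicator hM, ← hmp.lintegral_comp (hmeas.indicator hM),
    Measure.volume_eq_prod, lintegral_prod]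
  · congr with k
    have hm : MeasurableSet {y : Kᗮ | (k : E) + y ∈ M} := by
      have : Measurable (fun y : Kᗮ => (k : E) + y) := by fun_prop
      exact this hM
    rw [← lintegral_const_mul' _ _ ENNReal.ofReal_ne_top, ← lintegral_indicator hm]
    congr with y
    by_cases hy : (k : E) + y ∈ M
    · rw [Set.indicator_of_mem hy, Set.indicator_of_mem (by exact hy),
        ← ENNReal.ofReal_mul (Real.exp_pos _).le, ← Real.exp_add]
      have : ‖(k : E) + y‖ ^ 2 = ‖k‖ ^ 2 + ‖y‖ ^ 2 := by
        rw [sq, norm_add_sq_eq_norm_sq_add_norm_sq_of_inner_eq_zero (k : E) (y : E)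
          (Submodule.inner_right_of_mem_orthogonal k.2 y.2)]
        simp [sq]
      rw [this]
      ring_nf
    · rw [Set.indicator_of_notMem hy, Set.indicator_of_notMem (by exact hy)]
  · exact ((hmeas.indicator hM).comp hmp.measurable).aemeasurable

end Gauss

/-- Resolved sets have small Gaussian mass. -/
theorem lintegral_exp_le_of_resolved {τ : ℝ} (hτ : 0 < τ) {r : ℕ} (hr : 0 < r) (l : ℕ) :
    ∀ (E : Type w) [NormedAddCommGroup E] [InnerProductSpace ℝ E] [FiniteDimensional ℝ E]
      [MeasurableSpace E] [BorelSpace E] (M : Set E), MeasurableSet M → Resolved τ l M →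
      Module.finrank ℝ E = l + r →
    ∫⁻ x in M, ENNReal.ofReal (Real.exp (-‖x‖ ^ 2 / 2))
      ≤ ENNReal.ofReal ((2 * Real.pi) ^ (l / 2 : ℝ)) *
        ENNReal.ofReal (Real.exp r * (Real.pi * τ ^ 2 / r) ^ (r / 2 : ℝ)) := by
  induction l with
  | zero =>
    intro E _ _ _ _ _ M hM hR hE
    simpa using lintegral_exp_le_of_diam_le hτ M hM hR hr (by simpa using hE)
  | succ l ih =>
    intro E _ _ _ _ _ M hM hR hE
    obtain ⟨L, hL⟩ := hR
    obtain ⟨v, hv, hvL⟩ : ∃ v : E, v ≠ 0 ∧ ∀ y ∈ (ℝ ∙ v)ᗮ, L y = 0 := by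
      let u : E := (InnerProductSpace.toDual ℝ E).symm L.toContinuousLinearMap
      have hu : ∀ y, L y = inner ℝ u y := fun y => by
        simp [u]
      by_cases h0 : u = 0
      · have : Nontrivial E := Module.nontrivial_of_finrank_pos (R := ℝ) (by omega)
        obtain ⟨v, hv⟩ := exists_ne (0 : E)
        exact ⟨v, hv, fun y _ => by rw [hu, h0, inner_zero_left]⟩
      · exact ⟨u, h0, fun y hy => by
          rw [hu, Submodule.mem_orthogonal_singleton_iff_inner_right.1 hy]⟩
    have hK : Module.finrank ℝ (ℝ ∙ v) = 1 := finrank_span_singleton hv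
    have hK' : Module.finrank ℝ ((ℝ ∙ v)ᗮ : Submodule ℝ E) = l + r := by
      have := (ℝ ∙ v).finrank_add_finrank_orthogonal
      omega
    rw [lintegral_exp_eq_lintegral_orthogonal (ℝ ∙ v) hM]
    have key : ∀ k : (ℝ ∙ v),
        ∫⁻ y in {y : ((ℝ ∙ v)ᗮ : Submodule ℝ E) | (k : E) + y ∈ M},
          ENNReal.ofReal (Real.exp (-‖y‖ ^ 2 / 2))
        ≤ ENNReal.ofReal ((2 * Real.pi) ^ (l / 2 : ℝ)) *
          ENNReal.ofReal (Real.exp r * (Real.pi * τ ^ 2 / r) ^ (r / 2 : ℝ)) := by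
      intro k
      refine ih _ _ ?_ ?_ hK'
      · have : Measurable (fun y : ((ℝ ∙ v)ᗮ : Submodule ℝ E) => (k : E) + y) := by fun_prop
        exact this hM
      · have hset : {y : ((ℝ ∙ v)ᗮ : Submodule ℝ E) | (k : E) + y ∈ M}
            = {y | (k : E) + ((ℝ ∙ v)ᗮ).subtypeₗᵢ y ∈ M ∩ {x | L x = L k}} := by
          refine Set.ext fun y => ?_
          simp [hvL y y.2]
        rw [hset]
        exact Resolved.preimage ((ℝ ∙ v)ᗮ).subtypeₗᵢ l _ (k : E) (hL (L k))
    refine (lintegral_mono fun k => mul_le_mul_right (key k) _).trans ?_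
    rw [lintegral_mul_const' _ _ (ENNReal.mul_ne_top ENNReal.ofReal_ne_top ENNReal.ofReal_ne_top),
      lintegral_exp_neg_half_sq_norm, hK, ← mul_assoc, ← ENNReal.ofReal_mul (by positivity),
      ← Real.rpow_add (by positivity)]
    apply le_of_eq
    congr 3
    push_cast
    ring

theorem Resolved.scale {E : Type*} [NormedAddCommGroup E] [NormedSpace ℝ E] {c : ℝ} (hc : 0 < c)
    {τ : ℝ} : ∀ (l : ℕ) (M : Set E), Resolved τ l M → Resolved (c * τ) l {x : E | c⁻¹ • x ∈ M}
  | 0, M, h => fun x hx y hy => by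
      have := h _ hx _ hy
      rw [← smul_sub, norm_smul, Real.norm_of_nonneg (inv_nonneg.2 hc.le)] at this
      rwa [inv_mul_le_iff₀ hc] at this
  | l + 1, M, ⟨L, hL⟩ => by
      refine ⟨L.comp (c⁻¹ • LinearMap.id), fun t => ?_⟩
      convert Resolved.scale hc l _ (hL t) using 1
      ext x
      simp

/-- There is a probability measure, concentrated on the unit ball up to a quarter of its mass,
for which sets resolved by few measurements are small. -/
theorem exists_measure_resolved_le {E : Type w} [NormedAddCommGroup E] [InnerProductSpace ℝ E]
    [FiniteDimensional ℝ E] [MeasurableSpace E] [BorelSpace E] {l r : ℕ} (hr : 0 < r)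
    (hlr : l ≤ r) (hE : Module.finrank ℝ E = l + r) :
    ∃ μ : Measure E, IsProbabilityMeasure μ ∧ μ (Metric.closedBall 0 1)ᶜ ≤ 1 / 4 ∧
      ∀ M : Set E, MeasurableSet M → Resolved (1 / 64) l M → μ M ≤ 1 / 4 := by
  set d : ℝ := l + r with hd
  have hr0 : (1 : ℝ) ≤ r := by exact_mod_cast hr
  have hl0 : (0 : ℝ) ≤ l := Nat.cast_nonneg l
  have hd1 : 1 ≤ d := by linarith
  have hdr : d ≤ 2 * r := by
    have : (l : ℝ) ≤ r := by exact_mod_cast hlr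
    linarith
  have hEd : ((Module.finrank ℝ E : ℕ) : ℝ) = d := by rw [hE]; push_cast; rfl
  have hpi : 0 < 2 * Real.pi := by positivity
  let g : E → ℝ≥0∞ := fun x => ENNReal.ofReal (Real.exp (-‖x‖ ^ 2 / 2))
  have hg : Measurable g := by fun_prop
  let γ : Measure E := ENNReal.ofReal ((2 * Real.pi) ^ (-(d / 2))) • volume.withDensity g
  have hγ : ∀ M, MeasurableSet M →
      γ M = ENNReal.ofReal ((2 * Real.pi) ^ (-(d / 2))) * ∫⁻ x in M, g x := fun M hM => by
    simp only [γ, Measure.smul_apply, withDensity_apply _ hM, smul_eq_mul]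
  have hγbd : ∀ (M : Set E) (q : ℝ), MeasurableSet M → q ≤ 1 / 4 →
      ∫⁻ x in M, g x ≤ ENNReal.ofReal ((2 * Real.pi) ^ (d / 2) * q) → γ M ≤ 1 / 4 := by
    intro M q hM hq h
    rw [hγ M hM]
    refine (mul_le_mul_right h _).trans ?_
    rw [← ENNReal.ofReal_mul (by positivity), ← mul_assoc, ← Real.rpow_add hpi, neg_add_cancel,
      Real.rpow_zero, one_mul]
    refine (ENNReal.ofReal_le_ofReal hq).trans (le_of_eq ?_)
    rw [ENNReal.ofReal_div_of_pos (by norm_num)]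
    simp
  have hγp : IsProbabilityMeasure γ := ⟨by
    rw [hγ _ MeasurableSet.univ, Measure.restrict_univ, lintegral_exp_neg_half_sq_norm, hEd,
      ← ENNReal.ofReal_mul (by positivity), ← Real.rpow_add hpi, neg_add_cancel, Real.rpow_zero,
      ENNReal.ofReal_one]⟩
  have hexp2 : Real.exp (-2) ≤ 1 / 4 := by
    rw [Real.exp_neg, one_div]
    refine inv_anti₀ (by norm_num) ?_
    have := Real.add_one_le_exp (1 : ℝ)
    calc (4 : ℝ) ≤ Real.exp 1 * Real.exp 1 := by nlinarith
      _ = Real.exp 2 := by rw [← Real.exp_add]; norm_num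
  have hRpos : 0 < 4 * √d := by positivity
  have hsm : Measurable (fun x : E => (4 * √d)⁻¹ • x) := by fun_prop
  refine ⟨γ.map fun x => (4 * √d)⁻¹ • x, Measure.isProbabilityMeasure_map hsm.aemeasurable, ?_, ?_⟩
  · rw [Measure.map_apply hsm Metric.isClosed_closedBall.measurableSet.compl]
    refine hγbd _ (Real.exp (-2)) (hsm Metric.isClosed_closedBall.measurableSet.compl) hexp2 ?_
    calc ∫⁻ x in (fun x : E => (4 * √d)⁻¹ • x) ⁻¹' (Metric.closedBall 0 1)ᶜ, g x
        ≤ ∫⁻ x in (fun x : E => (4 * √d)⁻¹ • x) ⁻¹' (Metric.closedBall 0 1)ᶜ,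
            ENNReal.ofReal (Real.exp (-(4 * d))) *
              ENNReal.ofReal (Real.exp (-(1 / 4) * ‖x‖ ^ 2)) := by
          refine setLIntegral_mono' (hsm Metric.isClosed_closedBall.measurableSet.compl)
            fun x hx => ?_
          have h1 : 4 * √d < ‖x‖ := by
            simp only [Set.mem_preimage, Set.mem_compl_iff, Metric.mem_closedBall, dist_zero_right,
              norm_smul, norm_inv, Real.norm_of_nonneg hRpos.le, not_le] at hx
            rwa [lt_inv_mul_iff₀ hRpos, mul_one] at hx
          have h2 : 16 * d ≤ ‖x‖ ^ 2 := by
            have := pow_le_pow_left₀ hRpos.le h1.le 2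
            rw [mul_pow, Real.sq_sqrt (by linarith)] at this
            linarith
          rw [← ENNReal.ofReal_mul (Real.exp_pos _).le, ← Real.exp_add]
          exact ENNReal.ofReal_le_ofReal (Real.exp_le_exp.2 (by linarith))
      _ ≤ ∫⁻ x : E, ENNReal.ofReal (Real.exp (-(4 * d))) *
              ENNReal.ofReal (Real.exp (-(1 / 4) * ‖x‖ ^ 2)) := setLIntegral_le_lintegral _ _
      _ = ENNReal.ofReal (Real.exp (-(4 * d)) * (4 * Real.pi) ^ (d / 2)) := by
          rw [lintegral_const_mul' _ _ ENNReal.ofReal_ne_top,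
            lintegral_exp_neg_mul_sq_norm (by norm_num), hEd,
            ← ENNReal.ofReal_mul (Real.exp_pos _).le]
          congr 3
          ring
      _ ≤ _ := by
          refine ENNReal.ofReal_le_ofReal ?_
          rw [show 4 * Real.pi = (2 * Real.pi) * 2 by ring,
            Real.mul_rpow hpi.le (by norm_num), mul_left_comm]
          refine mul_le_mul_of_nonneg_left ?_ (by positivity)
          have h2 : (2 : ℝ) ^ (d / 2) ≤ Real.exp (d / 2) := by
            rw [← Real.exp_one_rpow]
            exact Real.rpow_le_rpow (by norm_num)
              (by have := Real.add_one_le_exp (1 : ℝ); linarith) (by linarith)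
          calc Real.exp (-(4 * d)) * (2 : ℝ) ^ (d / 2)
              ≤ Real.exp (-(4 * d)) * Real.exp (d / 2) := by gcongr
            _ = Real.exp (-(4 * d) + d / 2) := (Real.exp_add _ _).symm
            _ ≤ Real.exp (-2) := Real.exp_le_exp.2 (by linarith)
  · intro M hM hR
    rw [Measure.map_apply hsm hM]
    have hR' := hR.scale hRpos
    refine hγbd _ (Real.exp 1 / 16) (hsm hM) ?_ ?_
    · have := Real.exp_one_lt_d9
      linarith
    refine (lintegral_exp_le_of_resolved (by positivity) hr l E _ (hsm hM) hR' hE).trans ?_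
    rw [← ENNReal.ofReal_mul (by positivity)]
    refine ENNReal.ofReal_le_ofReal ?_
    have hτ : (4 * √d * (1 / 64)) ^ 2 = d / 256 := by
      rw [mul_pow, mul_pow, Real.sq_sqrt (by linarith)]
      ring
    have h1 : Real.pi * (4 * √d * (1 / 64)) ^ 2 / r ≤ 2 * Real.pi * (1 / 256) := by
      rw [hτ, div_le_iff₀ (by linarith)]
      have := Real.pi_pos
      nlinarith
    have h2 : ((1 : ℝ) / 256) ^ (r / 2 : ℝ) = (1 / 16) ^ r := by
      rw [show (1 : ℝ) / 256 = (1 / 16) ^ (2 : ℝ) by norm_num, ← Real.rpow_mul (by norm_num),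
        mul_div_cancel₀ _ (by norm_num), Real.rpow_natCast]
    calc (2 * Real.pi) ^ (l / 2 : ℝ) *
          (Real.exp r * (Real.pi * (4 * √d * (1 / 64)) ^ 2 / r) ^ (r / 2 : ℝ))
        ≤ (2 * Real.pi) ^ (l / 2 : ℝ) * (Real.exp r * (2 * Real.pi * (1 / 256)) ^ (r / 2 : ℝ)) := by
          gcongr
      _ = (2 * Real.pi) ^ (d / 2) * (Real.exp 1 / 16) ^ r := by
          rw [Real.mul_rpow hpi.le (by norm_num), h2, hd, add_div, Real.rpow_add hpi,
            div_pow (Real.exp 1), ← Real.exp_nat_mul, mul_one, div_pow, one_pow]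
          ring
      _ ≤ _ := by
          refine mul_le_mul_of_nonneg_left ?_ (by positivity)
          refine pow_le_of_le_one (by positivity) ?_ hr.ne'
          have := Real.exp_one_lt_d9
          linarith

section RealDim

/-- The dimension of `𝕜` over the reals. -/
noncomputable def realDim (𝕜 : Type*) [RCLike 𝕜] : ℕ :=
  open Classical in if (RCLike.I : 𝕜) = 0 then 1 else 2

variable {𝕜 X : Type*} [RCLike 𝕜] [NormedAddCommGroup X] [NormedSpace 𝕜 X] [NormedSpace ℝ X]
  [IsScalarTower ℝ 𝕜 X]

/-- The real part of a functional. -/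
noncomputable def reFunctional (c : X →L[𝕜] 𝕜) : X →ₗ[ℝ] ℝ :=
  (RCLike.reLm : 𝕜 →ₗ[ℝ] ℝ) ∘ₗ (c.toLinearMap.restrictScalars ℝ)

/-- The imaginary part of a functional. -/
noncomputable def imFunctional (c : X →L[𝕜] 𝕜) : X →ₗ[ℝ] ℝ :=
  (RCLike.imLm : 𝕜 →ₗ[ℝ] ℝ) ∘ₗ (c.toLinearMap.restrictScalars ℝ)

@[simp] theorem reFunctional_apply (c : X →L[𝕜] 𝕜) (x : X) :
    reFunctional c x = RCLike.re (c x) := rfl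

@[simp] theorem imFunctional_apply (c : X →L[𝕜] 𝕜) (x : X) :
    imFunctional c x = RCLike.im (c x) := rfl

theorem map_real_smul_of_tower {V : Type*} [NormedAddCommGroup V] [NormedSpace 𝕜 V]
    (T : X →L[𝕜] V) (r : ℝ) (x : X) : T (r • x) = (r : 𝕜) • T x := by
  rw [← map_smul, RCLike.real_smul_eq_coe_smul (K := 𝕜)]

theorem norm_map_real_smul {V : Type*} [NormedAddCommGroup V] [NormedSpace 𝕜 V]
    (T : X →L[𝕜] V) (r : ℝ) (x : X) : ‖T (r • x)‖ = |r| * ‖T x‖ := by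
  rw [map_real_smul_of_tower, norm_smul, RCLike.norm_ofReal]

variable {E : Type*} [NormedAddCommGroup E] [NormedSpace ℝ E]

theorem Resolved.of_functional {τ : ℝ} {l : ℕ} {M : Set E} (z : X) (A : E →ₗ[ℝ] X)
    (c : X →L[𝕜] 𝕜) (h : ∀ t : 𝕜, Resolved τ l (M ∩ {x | c (z + A x) = t})) :
    Resolved τ (l + realDim 𝕜) M := by
  unfold realDim
  split_ifs with hI
  · refine ⟨reFunctional c ∘ₗ A, fun t => ?_⟩
    convert h (c z + (t : 𝕜)) using 2
    ext x
    simp only [LinearMap.comp_apply, reFunctional_apply, Set.mem_ofPred_eq, map_add,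
      add_right_inj]
    rw [RCLike.ext_iff (z := c (A x)), RCLike.im_eq_zero hI, RCLike.im_eq_zero hI]
    simp
  · refine ⟨reFunctional c ∘ₗ A, fun t => ⟨imFunctional c ∘ₗ A, fun u => ?_⟩⟩
    convert h (c z + ((t : 𝕜) + (u : 𝕜) * RCLike.I)) using 1
    ext x
    have him : RCLike.im (RCLike.I : 𝕜) = 1 := (RCLike.I_eq_zero_or_im_I_eq_one).resolve_left hI
    simp only [LinearMap.comp_apply, reFunctional_apply, imFunctional_apply, Set.mem_inter_iff,
      Set.mem_ofPred_eq, map_add, add_right_inj]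
    rw [RCLike.ext_iff (z := c (A x))]
    simp [him, and_assoc]

theorem Resolved.of_adaptiveInfo {τ : ℝ} {M : Set E} (z : X) (A : E →ₗ[ℝ] X)
    (L : (k : ℕ) → (Fin k → 𝕜) → (X →L[𝕜] 𝕜)) (n : ℕ)
    (h : ∀ x ∈ M, ∀ y ∈ M, adaptiveInfo L (z + A x) n = adaptiveInfo L (z + A y) n →
      ‖x - y‖ ≤ τ) :
    Resolved τ (realDim 𝕜 * n) M := by
  have key : ∀ i j : ℕ, j + i = n → ∀ v : Fin j → 𝕜,
      Resolved τ (realDim 𝕜 * i) (M ∩ {x | adaptiveInfo L (z + A x) j = v}) := by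
    intro i
    induction i with
    | zero =>
      rintro j rfl v x ⟨hx, hx'⟩ y ⟨hy, hy'⟩
      exact h x hx y hy (hx'.trans hy'.symm)
    | succ i ih =>
      intro j hj v
      rw [mul_add, mul_one]
      refine Resolved.of_functional z A (L j v) fun t => ?_
      convert ih (j + 1) (by omega) (Fin.snoc (α := fun _ => 𝕜) v t) using 1
      ext x
      simp only [Set.mem_inter_iff, Set.mem_ofPred_eq, and_assoc, adaptiveInfo]
      refine and_congr_right fun _ => ?_
      constructor
      · rintro ⟨h1, h2⟩
        rw [h1, h2]
      · intro h1
        obtain ⟨h2, h3⟩ := Fin.snoc_injective2 h1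
        rw [h2] at h3
        exact ⟨h2, h3⟩
  have := key n 0 (zero_add n) Fin.elim0
  convert this using 1
  ext x
  simp [adaptiveInfo]

end RealDim

section ClassTopology

variable {𝕜 X : Type*} [RCLike 𝕜] [NormedAddCommGroup X] [NormedSpace 𝕜 X] [NormedSpace ℝ X]

theorem gauge_add_le_of_mem {D : Set X} (hD : Convex ℝ D) {x y : X} {r : ℝ} (hr : 0 ≤ r)
    (hx : x ∈ D) (hy : y ∈ r • D) : gauge D (x + y) ≤ gauge D x + r := by
  refine le_of_forall_pos_le_add fun ε hε => ?_
  have hne : {q : ℝ | q ∈ Set.Ioi 0 ∧ x ∈ q • D}.Nonempty := ⟨1, by simp, by simpa using hx⟩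
  obtain ⟨q, ⟨hq0, hqx⟩, hq⟩ := exists_lt_of_csInf_lt hne
    (show sInf {q : ℝ | q ∈ Set.Ioi 0 ∧ x ∈ q • D} < gauge D x + ε from by
      rw [← gauge_def]; linarith)
  have hq0' : (0 : ℝ) < q := hq0
  have : x + y ∈ (q + r) • D := by
    rw [hD.add_smul hq0'.le hr]
    exact Set.add_mem_add hqx hy
  have := gauge_le_of_mem (by positivity) this
  linarith

theorem exists_mem_smul_of_gauge_lt {D : Set X} {x : X} {r : ℝ} (hx : x ∈ D)
    (h : gauge D x < r) : ∃ q, 0 < q ∧ q < r ∧ x ∈ q • D := by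
  have hne : {q : ℝ | q ∈ Set.Ioi 0 ∧ x ∈ q • D}.Nonempty := ⟨1, by simp, by simpa using hx⟩
  obtain ⟨q, ⟨hq0, hqx⟩, hq⟩ := exists_lt_of_csInf_lt hne
    (show sInf {q : ℝ | q ∈ Set.Ioi 0 ∧ x ∈ q • D} < r from by rwa [← gauge_def])
  exact ⟨q, hq0, hq, hqx⟩

/-- The radial retraction onto the unit ball. -/
noncomputable def ballRetraction {E : Type*} [NormedAddCommGroup E] [NormedSpace ℝ E] (x : E) : E :=
  (max 1 ‖x‖)⁻¹ • x

section Retraction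

variable {E : Type*} [NormedAddCommGroup E] [NormedSpace ℝ E]

theorem norm_ballRetraction_le (x : E) : ‖ballRetraction x‖ ≤ 1 := by
  have h : 0 < max 1 ‖x‖ := lt_of_lt_of_le one_pos (le_max_left _ _)
  rw [ballRetraction, norm_smul, norm_inv, Real.norm_of_nonneg h.le, inv_mul_le_iff₀ h, mul_one]
  exact le_max_right _ _

theorem ballRetraction_of_norm_le {x : E} (hx : ‖x‖ ≤ 1) : ballRetraction x = x := by
  rw [ballRetraction, max_eq_left hx, inv_one, one_smul]

theorem continuous_ballRetraction : Continuous (ballRetraction : E → E) := by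
  unfold ballRetraction
  refine Continuous.smul (Continuous.inv₀ (by fun_prop) fun x => ?_) continuous_id
  exact (lt_of_lt_of_le one_pos (le_max_left _ _)).ne'

end Retraction

theorem measurable_ball_param {E : Type*} [NormedAddCommGroup E] [NormedSpace ℝ E]
    [MeasurableSpace E] [BorelSpace E] {F : Set X} (hF : Convex ℝ F) (z : X) (A : E →ₗ[ℝ] X)
    (h : ∀ x, ‖x‖ ≤ 1 → z + A x ∈ F) :
    Measurable[_, classBorel F]
      (fun x => (⟨z + A (ballRetraction x), h _ (norm_ballRetraction_le x)⟩ : F)) := by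
  let _ : TopologicalSpace F := classTopology F
  let _ : MeasurableSpace F := classBorel F
  have : BorelSpace F := ⟨rfl⟩
  refine Continuous.measurable ?_
  refine continuous_generateFrom_iff.2 ?_
  rintro _ ⟨f, r, rfl⟩
  rw [isOpen_iff_mem_nhds]
  intro x hx
  simp only [Set.mem_preimage, Set.mem_ofPred_eq] at hx
  set ε := r - gauge (F - F) (z + A (ballRetraction x) - f) with hε
  have hε0 : 0 < ε := sub_pos.2 hx
  have hnear : ∀ᶠ y in nhds x, ‖ballRetraction y - ballRetraction x‖ < ε / 2 := by
    have := (continuous_ballRetraction (E := E)).tendsto x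
    rw [Metric.tendsto_nhds] at this
    simpa [dist_eq_norm] using this (ε / 2) (by positivity)
  filter_upwards [hnear] with y hy
  simp only [Set.mem_preimage, Set.mem_ofPred_eq]
  have hmem : A (ballRetraction y - ballRetraction x) ∈ (ε / 2) • (F - F) := by
    refine ⟨A ((ε / 2)⁻¹ • (ballRetraction y - ballRetraction x)), ?_, ?_⟩
    · refine ⟨_, h ((ε / 2)⁻¹ • (ballRetraction y - ballRetraction x)) ?_, _, h 0 (by simp), ?_⟩
      · rw [norm_smul, norm_inv, Real.norm_of_nonneg (by positivity),
          inv_mul_le_iff₀ (by positivity), mul_one]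
        exact hy.le
      · simp
    · simp only
      rw [← map_smul, smul_smul, mul_inv_cancel₀ (by positivity), one_smul]
  have := gauge_add_le_of_mem (hF.sub hF) (by positivity)
    (Set.sub_mem_sub (h _ (norm_ballRetraction_le x)) f.2) hmem
  rw [map_sub] at this
  have heq : z + A (ballRetraction x) - f + (A (ballRetraction y) - A (ballRetraction x))
      = z + A (ballRetraction y) - f := by abel
  rw [heq] at this
  linarith

/-- Continuous linear maps are continuous on a bounded class with its own topology. -/
theorem continuous_classTopology [IsScalarTower ℝ 𝕜 X] {V : Type*} [NormedAddCommGroup V]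
    [NormedSpace 𝕜 V] {F : Set X} (hF : Bornology.IsBounded F) (T : X →L[𝕜] V) :
    @Continuous F V (classTopology F) _ (fun f : F => T f) := by
  let _ : TopologicalSpace F := classTopology F
  obtain ⟨R, hR⟩ := (hF.sub hF).exists_norm_le
  rw [continuous_iff_continuousAt]
  intro f
  rw [ContinuousAt, Metric.tendsto_nhds]
  intro ε hε
  have hC : 0 < ‖T‖ * R + 1 := by
    have : 0 ≤ R := (norm_nonneg _).trans (hR _ (Set.sub_mem_sub f.2 f.2))
    positivity
  have hopen : IsOpen {g : F | gauge (F - F) ((g : X) - (f : X)) < ε / (‖T‖ * R + 1)} :=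
    TopologicalSpace.isOpen_generateFrom_of_mem ⟨f, _, rfl⟩
  have hmem : f ∈ {g : F | gauge (F - F) ((g : X) - (f : X)) < ε / (‖T‖ * R + 1)} := by
    simp only [Set.mem_ofPred_eq, sub_self, gauge_zero]
    positivity
  filter_upwards [hopen.mem_nhds hmem] with g hg
  obtain ⟨q, hq0, hq, d, hd, hdg⟩ := exists_mem_smul_of_gauge_lt (Set.sub_mem_sub g.2 f.2) hg
  rw [dist_eq_norm, ← map_sub, ← hdg]
  simp only
  rw [norm_map_real_smul, abs_of_pos hq0]
  have h1 : ‖T d‖ ≤ ‖T‖ * R := (T.le_opNorm d).trans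
    (mul_le_mul_of_nonneg_left (hR d hd) (norm_nonneg _))
  rw [lt_div_iff₀ hC] at hq
  nlinarith

end ClassTopology

section LowerBound

variable {𝕜 : Type a} {X : Type b} {Y : Type c} [RCLike 𝕜]
  [NormedAddCommGroup X] [NormedSpace 𝕜 X]

theorem IsNonadaptiveAlg.isAdaptiveAlg {n : ℕ} {F : Set X} {A : F → Y}
    (h : IsNonadaptiveAlg 𝕜 n F A) : IsAdaptiveAlg 𝕜 n F A := by
  obtain ⟨L, φ, hA⟩ := h
  let L' : (k : ℕ) → (Fin k → 𝕜) → (X →L[𝕜] 𝕜) :=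
    fun k _ => if h : k < n then L ⟨k, h⟩ else 0
  have key : ∀ (f : X) (m : ℕ) (i : Fin m), adaptiveInfo L' f m i = L' i 0 f := by
    intro f m
    induction m with
    | zero => exact fun i => i.elim0
    | succ m ih =>
      intro i
      refine Fin.lastCases ?_ (fun i => ?_) i
      · simp [adaptiveInfo, L']
      · simp only [adaptiveInfo, Fin.snoc_castSucc, ih]
        rfl
  refine ⟨L', φ, fun f => ?_⟩
  rw [hA]
  congr 1
  ext i
  rw [key]
  simp [L']

variable [NormedAddCommGroup Y] [NormedSpace 𝕜 Y] [NormedSpace ℝ X] [IsScalarTower ℝ 𝕜 X]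

/-- An algorithm with few measurements is accurate only on a resolved subset of a section of the
class on which `S` expands distances. -/
theorem resolved_of_isAdaptiveAlg {S : X →L[𝕜] Y} {F : Set X} {k : ℕ} {alg : F → Y}
    (halg : IsAdaptiveAlg 𝕜 k F alg) {E : Type*} [NormedAddCommGroup E] [NormedSpace ℝ E]
    {z : X} {A : E →ₗ[ℝ] X} {Θ : E → F} (hΘ : ∀ x, ‖x‖ ≤ 1 → (Θ x : X) = z + A x) {s : ℝ}
    (hs0 : 0 < s) (hs : ∀ x, s * ‖x‖ ≤ ‖S (A x)‖) {M : Set E}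
    (hM : ∀ x ∈ M, ‖x‖ ≤ 1 ∧ ‖S (Θ x) - alg (Θ x)‖ ≤ s / 128) :
    Resolved (1 / 64) (realDim 𝕜 * k) M := by
  obtain ⟨L, φ, hA⟩ := halg
  refine Resolved.of_adaptiveInfo z A L k fun x hx y hy hxy => ?_
  obtain ⟨hx1, hx2⟩ := hM x hx
  obtain ⟨hy1, hy2⟩ := hM y hy
  have heq : alg (Θ x) = alg (Θ y) := by rw [hA, hA, hΘ x hx1, hΘ y hy1, hxy]
  have h1 : S (A (x - y)) = (S (Θ x) - alg (Θ x)) - (S (Θ y) - alg (Θ y)) := by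
    rw [heq, hΘ x hx1, hΘ y hy1]
    simp
  have h2 := hs (x - y)
  rw [h1] at h2
  have h3 := norm_sub_le (S (Θ x) - alg (Θ x)) (S (Θ y) - alg (Θ y))
  have h4 : s * ‖x - y‖ ≤ s * (1 / 64) := by linarith
  exact le_of_mul_le_mul_left h4 hs0

theorem ofReal_le_minError {S : X →L[𝕜] Y} {F : Set X} (hF : Convex ℝ F)
    {E : Type*} [NormedAddCommGroup E] [InnerProductSpace ℝ E] [FiniteDimensional ℝ E]
    {z : X} {A : E →ₗ[ℝ] X} (hzA : ∀ x, ‖x‖ ≤ 1 → z + A x ∈ F) {s : ℝ}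
    (hs : ∀ x, s * ‖x‖ ≤ ‖S (A x)‖) {k r : ℕ} (hr : 0 < r) (hkr : realDim 𝕜 * k ≤ r)
    (hE : Module.finrank ℝ E = realDim 𝕜 * k + r) (cls : AlgClass) :
    ENNReal.ofReal (s / 256) ≤ minError.{w} cls k S F := by
  rcases le_or_gt s 0 with hs0 | hs0
  · rw [ENNReal.ofReal_of_nonpos (by linarith)]
    exact zero_le
  let _ : MeasurableSpace E := borel E
  have : BorelSpace E := ⟨rfl⟩
  obtain ⟨μ, hμ, hball, hres⟩ := exists_measure_resolved_le hr hkr hE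
  let Θ : E → F := fun x => ⟨z + A (ballRetraction x), hzA _ (norm_ballRetraction_le x)⟩
  have hΘ : ∀ x, ‖x‖ ≤ 1 → (Θ x : X) = z + A x := fun x hx => by
    simp only [Θ, ballRetraction_of_norm_le hx]
  have hΘm : Measurable[_, classBorel F] Θ := measurable_ball_param hF z A hzA
  have hcb : MeasurableSet (Metric.closedBall (0 : E) 1) := Metric.isClosed_closedBall.measurableSet
  have hlarge : ∀ alg : F → Y, IsAdaptiveAlg 𝕜 k F alg →
      MeasurableSet {x | ‖S (Θ x) - alg (Θ x)‖ ≤ s / 128} →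
      1 / 2 ≤ μ {x | ‖S (Θ x) - alg (Θ x)‖ ≤ s / 128}ᶜ := by
    intro alg halg hm
    have h1 := hres (Metric.closedBall 0 1 ∩ {x | ‖S (Θ x) - alg (Θ x)‖ ≤ s / 128}) (hcb.inter hm)
      (resolved_of_isAdaptiveAlg halg hΘ hs0 hs fun x hx => ⟨by simpa using hx.1, hx.2⟩)
    have h2 : (1 : ℝ≥0∞) ≤ 1 / 4 + 1 / 4 + μ {x | ‖S (Θ x) - alg (Θ x)‖ ≤ s / 128}ᶜ := by
      calc (1 : ℝ≥0∞) = μ Set.univ := measure_univ.symm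
        _ ≤ μ (((Metric.closedBall 0 1 ∩ {x | ‖S (Θ x) - alg (Θ x)‖ ≤ s / 128}) ∪
            (Metric.closedBall 0 1)ᶜ) ∪ {x | ‖S (Θ x) - alg (Θ x)‖ ≤ s / 128}ᶜ) := by
            refine measure_mono fun x _ => ?_
            simp only [Set.mem_union, Set.mem_inter_iff, Set.mem_compl_iff]
            tauto
        _ ≤ _ := (measure_union_le _ _).trans
            (add_le_add_left ((measure_union_le _ _).trans (add_le_add h1 hball)) _)
    have h3 : (1 / 4 + 1 / 4 : ℝ≥0∞) = 1 / 2 := by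
      rw [ENNReal.div_add_div_same, ENNReal.div_eq_div_iff] <;> norm_num
    rw [h3] at h2
    have h4 : (1 : ℝ≥0∞) - 1 / 2 = 1 / 2 := by simp
    rw [← h4]
    exact tsub_le_iff_left.2 h2
  have hdet : ∀ alg : F → Y, IsAdaptiveAlg 𝕜 k F alg →
      ENNReal.ofReal (s / 256) ≤ detError S F alg := by
    intro alg halg
    by_contra! hlt
    have hall : {x | ‖S (Θ x) - alg (Θ x)‖ ≤ s / 128} = Set.univ := by
      refine Set.eq_univ_of_forall fun x => ?_
      have h1 : ‖S (Θ x) - alg (Θ x)‖ₑ ≤ ENNReal.ofReal (s / 256) :=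
        (le_iSup (fun f : F => ‖S (f : X) - alg f‖ₑ) (Θ x)).trans hlt.le
      rw [← ofReal_norm, ENNReal.ofReal_le_ofReal_iff (by positivity)] at h1
      simp only [Set.mem_ofPred_eq]
      linarith
    have := hlarge alg halg (by rw [hall]; exact MeasurableSet.univ)
    rw [hall] at this
    simp at this
  have hran : ∀ 𝒜 : (F → Y) → Prop, (∀ alg, 𝒜 alg → IsAdaptiveAlg 𝕜 k F alg) →
      ENNReal.ofReal (s / 256) ≤ minRanError.{w} S F 𝒜 := by
    intro 𝒜 h𝒜
    refine le_iInf fun Ω => le_iInf fun mΩ => le_iInf fun P => le_iInf fun hP => le_iInf fun alg =>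
      le_iInf fun halg => le_iInf fun hmeas => ?_
    have herr : Measurable (fun p : E × Ω => ‖S (Θ p.1 : X) - alg p.2 (Θ p.1)‖) := by
      let _ : MeasurableSpace F := classBorel F
      have h1 : Measurable (fun p : E × Ω => (Θ p.1, p.2)) :=
        (hΘm.comp measurable_fst).prodMk measurable_snd
      exact Measurable.comp (g := fun p : F × Ω => ‖S (p.1 : X) - alg p.2 p.1‖) hmeas h1
    have herr' : Measurable (fun p : E × Ω => ‖S (Θ p.1 : X) - alg p.2 (Θ p.1)‖ₑ) := by
      simp_rw [← ofReal_norm]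
      exact herr.ennreal_ofReal
    calc ENNReal.ofReal (s / 256)
        = ∫⁻ _ : Ω, ENNReal.ofReal (s / 128) * (1 / 2) ∂P := by
          rw [lintegral_const, measure_univ, mul_one, one_div,
            show (2 : ℝ≥0∞)⁻¹ = ENNReal.ofReal (1 / 2) by simp,
            ← ENNReal.ofReal_mul (by positivity)]
          congr 1
          ring
      _ ≤ ∫⁻ ω, ∫⁻ x, ‖S (Θ x : X) - alg ω (Θ x)‖ₑ ∂μ ∂P := by
          refine lintegral_mono fun ω => ?_
          have hm : Measurable (fun x => ‖S (Θ x : X) - alg ω (Θ x)‖) :=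
            herr.comp measurable_prodMk_right
          have hms : MeasurableSet {x | ‖S (Θ x) - alg ω (Θ x)‖ ≤ s / 128} :=
            measurableSet_le hm measurable_const
          refine (mul_le_mul_right (hlarge (alg ω) (h𝒜 _ (halg ω)) hms) _).trans ?_
          rw [← setLIntegral_const]
          refine (setLIntegral_mono' hms.compl fun x hx => ?_).trans (setLIntegral_le_lintegral _ _)
          have hx' : s / 128 < ‖S (Θ x) - alg ω (Θ x)‖ := by simpa using hx
          rw [← ofReal_norm]
          exact ENNReal.ofReal_le_ofReal hx'.le
      _ = ∫⁻ x, ∫⁻ ω, ‖S (Θ x : X) - alg ω (Θ x)‖ₑ ∂P ∂μ :=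
          lintegral_lintegral_swap (herr'.comp measurable_swap).aemeasurable
      _ ≤ ∫⁻ _ : E, ranError P S F alg ∂μ :=
          lintegral_mono fun x => le_iSup (fun f : F => ∫⁻ ω, ‖S (f : X) - alg ω f‖ₑ ∂P) (Θ x)
      _ = ranError P S F alg := by rw [lintegral_const, measure_univ, mul_one]
  cases cls with
  | det => exact le_iInf₂ hdet
  | detNon => exact le_iInf₂ fun alg halg => hdet alg halg.isAdaptiveAlg
  | ran => exact hran _ fun _ h => h
  | ranNon => exact hran _ fun _ h => h.isAdaptiveAlg

end LowerBound

/-- A convex symmetric set in a finite-dimensional space is a neighbourhood of zero in its span. -/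
theorem exists_ball_subset_of_convex_symm {V : Type*} [NormedAddCommGroup V] [NormedSpace ℝ V]
    [FiniteDimensional ℝ V] {Q : Set V} (hQ : Convex ℝ Q) (hsymm : ∀ x ∈ Q, -x ∈ Q)
    (h0 : (0 : V) ∈ Q) :
    ∃ r > 0, ∀ v ∈ Submodule.span ℝ Q, ‖v‖ < r → v ∈ Q := by
  let W := Submodule.span ℝ Q
  let Q' : Set W := (↑) ⁻¹' Q
  have hQ' : Convex ℝ Q' := hQ.linear_preimage W.subtype
  have hspan : Submodule.span ℝ Q' = ⊤ := Submodule.span_span_coe_preimage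
  have h0' : (0 : W) ∈ Q' := by simpa [Q'] using h0
  have haff : affineSpan ℝ Q' = ⊤ := by
    rw [AffineSubspace.affineSpan_eq_top_iff_vectorSpan_eq_top_of_nonempty ℝ W W ⟨0, h0'⟩,
      vectorSpan_eq_span_vsub_set_right ℝ h0']
    simpa using hspan
  obtain ⟨x, hx⟩ := (hQ'.interior_nonempty_iff_affineSpan_eq_top).2 haff
  have hx' : -x ∈ Q' := by
    have := hsymm _ (interior_subset hx : x ∈ Q')
    simpa [Q'] using this
  have h0i : (0 : W) ∈ interior Q' := by
    have := hQ'.combo_interior_self_mem_interior hx hx' (a := 1 / 2) (b := 1 / 2) (by norm_num)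
      (by norm_num) (by norm_num)
    simpa using this
  obtain ⟨r, hr, hball⟩ := Metric.isOpen_iff.1 isOpen_interior 0 h0i
  refine ⟨r, hr, fun v hv hvr => ?_⟩
  have : (⟨v, hv⟩ : W) ∈ Metric.ball (0 : W) r := by simpa using hvr
  have hmem : (⟨v, hv⟩ : W) ∈ Q' := interior_subset (hball this)
  exact hmem

/-- A countably valued measurable rounding of a separable metric space. -/
theorem exists_measurable_rounding (V : Type*) [PseudoMetricSpace V]
    [TopologicalSpace.SeparableSpace V] [Nonempty V] [MeasurableSpace V] [BorelSpace V] {ε : ℝ}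
    (hε : 0 < ε) :
    ∃ c : V → ℕ, Measurable c ∧ ∀ x y, c x = c y → dist x y ≤ ε := by
  classical
  have hex : ∀ x : V, ∃ n, dist x (TopologicalSpace.denseSeq V n) < ε / 2 := fun x => by
    obtain ⟨_, h, ⟨n, rfl⟩⟩ := Metric.dense_iff.1 (TopologicalSpace.denseRange_denseSeq V) x (ε / 2)
      (by positivity)
    exact ⟨n, by rw [dist_comm]; exact h⟩
  refine ⟨fun x => Nat.find (hex x), measurable_find hex fun n => ?_, fun x y h => ?_⟩
  · exact (measurableSet_lt (by fun_prop) measurable_const)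
  · have h1 := Nat.find_spec (hex x)
    have h2 := Nat.find_spec (hex y)
    simp only at h
    rw [← h] at h2
    have := dist_triangle_right x y (TopologicalSpace.denseSeq V (Nat.find (hex x)))
    linarith

section UpperBound

variable {𝕜 : Type a} {X : Type b} {Y : Type c} [RCLike 𝕜]
  [NormedAddCommGroup X] [NormedSpace 𝕜 X] [NormedSpace ℝ X] [IsScalarTower ℝ 𝕜 X]
  [NormedAddCommGroup Y] [NormedSpace 𝕜 Y]

theorem exists_norm_le_of_kernel {S : X →L[𝕜] Y} {F : Set X} (hF : Convex ℝ F)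
    (hb : Bornology.IsBounded F) (hne : F.Nonempty) {p : ℕ} (L : Fin p → (X →L[𝕜] 𝕜)) {δ : ℝ}
    (hδ : 0 ≤ δ)
    (h : ∀ x ∈ F - F, (∀ i, L i x = 0) → ‖S x‖ ≤ δ) {η : ℝ} (hη : 0 < η) :
    ∃ ε > 0, ∀ x ∈ F - F, ‖fun i => L i x‖ ≤ ε → ‖S x‖ ≤ δ + η := by
  let T : X →ₗ[ℝ] (Fin p → 𝕜) := LinearMap.pi fun i => (L i).toLinearMap.restrictScalars ℝ
  have hT : ∀ x i, T x i = L i x := fun x i => rfl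
  have hD : Convex ℝ (F - F) := hF.sub hF
  obtain ⟨f₀, hf₀⟩ := hne
  have hD0 : (0 : X) ∈ F - F := ⟨f₀, hf₀, f₀, hf₀, sub_self _⟩
  have hDs : ∀ x ∈ F - F, -x ∈ F - F := by
    rintro _ ⟨f, hf, g, hg, rfl⟩
    exact ⟨g, hg, f, hf, by simp⟩
  obtain ⟨R, hR⟩ := (hb.sub hb).exists_norm_le
  have hR0 : 0 ≤ R := (norm_nonneg _).trans (hR 0 hD0)
  obtain ⟨r, hr, hball⟩ := exists_ball_subset_of_convex_symm (Q := T '' (F - F))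
    (hD.linear_image T)
    (by rintro _ ⟨x, hx, rfl⟩; exact ⟨-x, hDs x hx, map_neg T x⟩)
    ⟨0, hD0, map_zero T⟩
  set B := δ + ‖S‖ * R with hB
  have hB0 : 0 ≤ B := by positivity
  set t := η / (B + 1) with ht
  have ht0 : 0 < t := by positivity
  refine ⟨t * r / 2, by positivity, fun x hx hLx => ?_⟩
  obtain ⟨d, hd, hdx⟩ : -(t⁻¹ • T x) ∈ T '' (F - F) := by
    refine hball _ (Submodule.neg_mem _ (Submodule.smul_mem _ _
      (Submodule.subset_span ⟨x, hx, rfl⟩))) ?_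
    rw [norm_neg, norm_smul, norm_inv, Real.norm_of_nonneg ht0.le, inv_mul_lt_iff₀ ht0]
    calc ‖T x‖ = ‖fun i => L i x‖ := rfl
      _ ≤ t * r / 2 := hLx
      _ < t * r := by linarith [mul_pos ht0 hr]
  have hx' : (1 + t)⁻¹ • (x + t • d) ∈ F - F := by
    have := hD hx hd (a := (1 + t)⁻¹) (b := (1 + t)⁻¹ * t) (by positivity) (by positivity)
      (by field_simp)
    rwa [mul_smul, ← smul_add] at this
  have hker : T ((1 + t)⁻¹ • (x + t • d)) = 0 := by
    rw [map_smul, map_add, map_smul, hdx, smul_neg, smul_smul, mul_inv_cancel₀ ht0.ne', one_smul,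
      add_neg_cancel, smul_zero]
  have h1 := h _ hx' fun i => by rw [← hT, hker]; rfl
  rw [norm_map_real_smul, abs_of_pos (by positivity), inv_mul_le_iff₀ (by positivity)] at h1
  have h2 : ‖S (t • d)‖ ≤ t * (‖S‖ * R) := by
    rw [norm_map_real_smul, abs_of_pos ht0]
    gcongr
    exact (S.le_opNorm d).trans (mul_le_mul_of_nonneg_left (hR d hd) (norm_nonneg _))
  have h3 : ‖S x‖ ≤ ‖S (x + t • d)‖ + ‖S (t • d)‖ := by
    have : S x = S (x + t • d) - S (t • d) := by simp
    rw [this]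
    exact norm_sub_le _ _
  have h4 : t * B ≤ η := by
    rw [ht, div_mul_eq_mul_div, div_le_iff₀ (by positivity)]
    nlinarith
  have h5 : t * B = t * δ + t * (‖S‖ * R) := by rw [hB, mul_add]
  linarith

theorem minError_le_of_kernel {S : X →L[𝕜] Y} {F : Set X} (hF : Convex ℝ F)
    (hb : Bornology.IsBounded F) {p : ℕ} (L : Fin p → (X →L[𝕜] 𝕜)) {δ : ℝ}
    (hδ : 0 ≤ δ) (h : ∀ x ∈ F - F, (∀ i, L i x = 0) → ‖S x‖ ≤ δ) (cls : AlgClass) :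
    minError.{w} cls p S F ≤ ENNReal.ofReal δ := by
  classical
  refine ENNReal.le_of_forall_pos_le_add fun η hη _ => ?_
  have hη' : (0 : ℝ) < η := hη
  obtain ⟨ε, hε, hεS⟩ : ∃ ε > 0, ∀ x ∈ F - F, ‖fun i => L i x‖ ≤ ε → ‖S x‖ ≤ δ + η := by
    rcases F.eq_empty_or_nonempty with rfl | hne
    · exact ⟨1, one_pos, by simp⟩
    · exact exists_norm_le_of_kernel hF hb hne L hδ h hη'
  let _ : MeasurableSpace 𝕜 := borel 𝕜
  have : BorelSpace 𝕜 := ⟨rfl⟩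
  obtain ⟨c, hc, hcε⟩ := exists_measurable_rounding (Fin p → 𝕜) hε
  let N : F → (Fin p → 𝕜) := fun f i => L i f
  let g : ℕ → Y := fun n => if hn : ∃ f : F, c (N f) = n then S (hn.choose : X) else 0
  let alg : F → Y := fun f => g (c (N f))
  have hnon : IsNonadaptiveAlg 𝕜 p F alg := ⟨L, fun y => g (c y), fun f => rfl⟩
  have herr : ∀ f : F, ‖S (f : X) - alg f‖ₑ ≤ ENNReal.ofReal δ + η := by
    intro f
    have hn : ∃ f' : F, c (N f') = c (N f) := ⟨f, rfl⟩
    have halg : alg f = S (hn.choose : X) := dif_pos hn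
    have h1 : ‖S ((f : X) - (hn.choose : X))‖ ≤ δ + η := by
      refine hεS _ (Set.sub_mem_sub f.2 hn.choose.2) ?_
      have h2 := hcε _ _ hn.choose_spec
      rw [dist_comm, dist_eq_norm] at h2
      have h3 : (fun i => L i ((f : X) - (hn.choose : X))) = N f - N hn.choose := by
        ext i
        simp [N]
      rwa [h3]
    rw [halg, ← map_sub, ← ofReal_norm]
    calc ENNReal.ofReal ‖S ((f : X) - (hn.choose : X))‖ ≤ ENNReal.ofReal (δ + η) :=
          ENNReal.ofReal_le_ofReal h1
      _ = ENNReal.ofReal δ + η := by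
          rw [ENNReal.ofReal_add hδ hη'.le, ENNReal.ofReal_coe_nnreal]
  have hdet : detError S F alg ≤ ENNReal.ofReal δ + η := iSup_le herr
  have hran : ∀ 𝒜 : (F → Y) → Prop, 𝒜 alg → minRanError.{w} S F 𝒜 ≤ ENNReal.ofReal δ + η := by
    intro 𝒜 h𝒜
    have hmeas : Measurable[classBorel F, _] (fun f : F => ‖S (f : X) - alg f‖) := by
      let _ : TopologicalSpace F := classTopology F
      let _ : MeasurableSpace F := classBorel F
      have : BorelSpace F := ⟨rfl⟩
      have hN : Measurable N :=
        (continuous_pi fun i => continuous_classTopology hb (L i)).measurable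
      have h1 : Measurable (fun q : F × ℕ => ‖S (q.1 : X) - g q.2‖) :=
        measurable_from_prod_countable_left fun n =>
          ((continuous_classTopology hb S).sub (continuous_const (y := g n))).norm.measurable
      exact h1.comp (measurable_id.prodMk (hc.comp hN))
    have hprod : HasMeasurableError (Ω := PUnit.{w + 1}) S F (fun _ => alg) := by
      let _ : MeasurableSpace F := classBorel F
      exact hmeas.comp measurable_fst
    refine (iInf₂_le PUnit.{w + 1} (inferInstance : MeasurableSpace PUnit.{w + 1})).trans
      ((iInf₂_le (Measure.dirac PUnit.unit.{w + 1})
        (inferInstance : IsProbabilityMeasure (Measure.dirac PUnit.unit.{w + 1}))).trans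
        ((iInf₂_le (fun _ => alg) fun _ => h𝒜).trans ((iInf_le _ hprod).trans ?_)))
    refine iSup_le fun f => ?_
    rw [lintegral_const, measure_univ, mul_one]
    exact herr f
  cases cls with
  | det => exact (iInf₂_le alg hnon.isAdaptiveAlg).trans hdet
  | detNon => exact (iInf₂_le alg hnon).trans hdet
  | ran => exact hran _ hnon.isAdaptiveAlg
  | ranNon => exact hran _ hnon

end UpperBound

section SingularValues

theorem exists_isometry_singularValues_mul_le {E E' : Type*} [NormedAddCommGroup E]
    [InnerProductSpace ℝ E] [FiniteDimensional ℝ E] [NormedAddCommGroup E']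
    [InnerProductSpace ℝ E'] [FiniteDimensional ℝ E'] (T : E →ₗ[ℝ] E') {m : ℕ}
    (hm : Module.finrank ℝ E = m) {d : ℕ} (hd : d ≤ m) {s : ℝ} (hs0 : 0 ≤ s)
    (hs : ∀ i < d, s ≤ T.singularValues i) :
    ∃ J : EuclideanSpace ℝ (Fin d) →ₗ[ℝ] E, (∀ x, ‖J x‖ = ‖x‖) ∧
      ∀ x, s * ‖x‖ ≤ ‖T (J x)‖ := by
  have hsym := T.isSymmetric_adjoint_comp_self
  let u : Fin d → E := fun i => hsym.eigenvectorBasis hm (Fin.castLE hd i)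
  have hu : Orthonormal ℝ u :=
    (hsym.eigenvectorBasis hm).orthonormal.comp _ (Fin.castLE_injective hd)
  have hTu : ∀ i, LinearMap.adjoint T (T (u i)) = (T.singularValues i ^ 2) • u i := fun i => by
    have := hsym.apply_eigenvectorBasis hm (Fin.castLE hd i)
    rw [← T.sq_singularValues_fin hm] at this
    exact this
  let J : EuclideanSpace ℝ (Fin d) →ₗ[ℝ] E :=
    { toFun := fun x => ∑ i, x i • u i
      map_add' := fun x y => by simp [add_smul, Finset.sum_add_distrib]
      map_smul' := fun r x => by simp [mul_smul, Finset.smul_sum] }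
  have hJ : ∀ x, J x = ∑ i, x i • u i := fun x => rfl
  refine ⟨J, fun x => ?_, fun x => ?_⟩
  · rw [← sq_eq_sq₀ (norm_nonneg _) (norm_nonneg _), ← real_inner_self_eq_norm_sq, hJ,
      hu.inner_sum, EuclideanSpace.real_norm_sq_eq]
    simp [sq]
  · refine le_of_sq_le_sq ?_ (norm_nonneg _)
    rw [← real_inner_self_eq_norm_sq, ← LinearMap.adjoint_inner_left, hJ, map_sum, map_sum]
    simp_rw [map_smul, hTu, smul_smul]
    rw [hu.inner_sum, mul_pow, EuclideanSpace.real_norm_sq_eq, Finset.mul_sum]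
    refine Finset.sum_le_sum fun i _ => ?_
    simp only [conj_trivial]
    have := pow_le_pow_left₀ hs0 (hs i i.2) 2
    nlinarith [sq_nonneg (x i)]

theorem abs_det_eq_prod_singularValues {m : ℕ} (M : Matrix (Fin m) (Fin m) ℝ) :
    |M.det| = ∏ i ∈ Finset.range m, (Matrix.toEuclideanLin M).singularValues i := by
  have h := (Matrix.toEuclideanLin M).normDet_eq_prod_singularValues
  rw [LinearMap.normDet_eq_abs_det, finrank_euclideanSpace_fin,
    Matrix.toEuclideanLin_eq_toLin_orthonormal, LinearMap.det_toLin] at h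
  rw [h, Matrix.toEuclideanLin_eq_toLin_orthonormal]

end SingularValues

theorem prod_range_mul_le_prod_pow {t : ℕ → ℝ} (ht : Antitone t) (h0 : ∀ i, 0 ≤ t i) (q n : ℕ) :
    ∏ i ∈ Finset.range (q * n), t i ≤ (∏ k ∈ Finset.range n, t (q * k)) ^ q := by
  induction n with
  | zero => simp
  | succ n ih =>
    rw [mul_add, mul_one, Finset.prod_range_add, Finset.prod_range_succ, mul_pow]
    refine mul_le_mul ih ?_ (Finset.prod_nonneg fun i _ => h0 _)
      (pow_nonneg (Finset.prod_nonneg fun i _ => h0 _) _)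
    calc ∏ i ∈ Finset.range q, t (q * n + i) ≤ ∏ _i ∈ Finset.range q, t (q * n) :=
          Finset.prod_le_prod (fun i _ => h0 _) fun i _ => ht (Nat.le_add_right _ _)
      _ = t (q * n) ^ q := by simp

theorem pow_le_prod_of_pow_le_prod {s : ℕ → ℝ} (hs : Antitone s) (h0 : ∀ i, 0 ≤ s i) {κ n : ℕ}
    (hκ : κ = 1 ∨ κ = 2) (hn : 1 ≤ n) {Δ : ℝ} (hΔ : 0 < Δ)
    (h : Δ ^ (2 * κ * n - (κ - 1)) ≤ ∏ i ∈ Finset.range (2 * κ * n - (κ - 1)), s i) :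
    Δ ^ n ≤ ∏ k ∈ Finset.range n, s (2 * κ * k - (κ - 1)) := by
  let t : ℕ → ℝ := fun i => s (i - (κ - 1))
  have ht : Antitone t := fun i j hij => hs (Nat.sub_le_sub_right hij _)
  have h1 : Δ ^ (2 * κ * n) ≤ ∏ i ∈ Finset.range (2 * κ * n), t i := by
    rcases hκ with rfl | rfl
    · simpa [t] using h
    · obtain ⟨m, hm⟩ : ∃ m, 2 * 2 * n = m + 1 := ⟨2 * 2 * n - 1, by omega⟩
      rw [hm] at h ⊢
      simp only [Nat.add_sub_cancel, Nat.reduceSub] at h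
      have hs0 : Δ ≤ s 0 := by
        by_contra! hlt
        have h2 : ∏ i ∈ Finset.range m, s i ≤ s 0 ^ m := by
          calc ∏ i ∈ Finset.range m, s i ≤ ∏ _i ∈ Finset.range m, s 0 :=
                Finset.prod_le_prod (fun i _ => h0 i) fun i _ => hs (Nat.zero_le i)
            _ = s 0 ^ m := by simp
        have h3 : s 0 ^ m < Δ ^ m := pow_lt_pow_left₀ hlt (h0 0) (by omega)
        linarith
      rw [Finset.prod_range_succ', pow_succ]
      simp only [t, Nat.reduceSub, Nat.add_sub_cancel, zero_tsub]
      exact mul_le_mul h hs0 hΔ.le (Finset.prod_nonneg fun i _ => h0 i)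
  have h2 := h1.trans (prod_range_mul_le_prod_pow ht (fun i => h0 _) (2 * κ) n)
  rw [mul_comm (2 * κ) n, pow_mul] at h2
  exact le_of_pow_le_pow_left₀ (by omega) (Finset.prod_nonneg fun i _ => h0 _) h2

section Triangular

variable {𝕜 : Type a} {X : Type b} {Y : Type c} [RCLike 𝕜]
  [NormedAddCommGroup X] [NormedSpace 𝕜 X] [NormedSpace ℝ X] [IsScalarTower ℝ 𝕜 X]
  [NormedAddCommGroup Y] [NormedSpace 𝕜 Y]

/-- A triangular system of vectors and functionals bounds the geometric mean of the minimal errors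
from below. -/
theorem ofReal_le_geomMeanError {S : X →L[𝕜] Y} {F : Set X} (hF : Convex ℝ F) {n m : ℕ}
    (hn : 1 ≤ n) (hm : m = 2 * realDim 𝕜 * n - (realDim 𝕜 - 1)) {x : Fin m → X}
    {g : Fin m → X →ₗ[ℝ] ℝ} (htri : ∀ i j, i < j → g i (x j) = 0) {η K ρ : ℝ} (hη : 0 < η)
    (hK : 0 < K) (hρ : 0 < ρ) (hdiag : ∀ i, η ≤ |g i (x i)|)
    (hgK : ∀ y, ∑ i, g i y ^ 2 ≤ K ^ 2 * ‖S y‖ ^ 2) {z : X}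
    (hz : ∀ a : EuclideanSpace ℝ (Fin m), ‖a‖ ≤ 1 → z + ρ • ∑ i, a i • x i ∈ F)
    (cls : AlgClass) :
    ENNReal.ofReal (ρ * η / K / 256) ≤ geomMeanError.{w} cls n S F := by
  have hκ : realDim 𝕜 = 1 ∨ realDim 𝕜 = 2 := by
    unfold realDim
    split_ifs <;> simp
  let A : EuclideanSpace ℝ (Fin m) →ₗ[ℝ] X :=
    { toFun := fun a => ρ • ∑ i, a i • x i
      map_add' := fun a b => by simp [add_smul, Finset.sum_add_distrib]
      map_smul' := fun r a => by
        simp only [PiLp.smul_apply, smul_eq_mul, mul_smul, ← Finset.smul_sum, RingHom.id_apply]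
        rw [smul_comm] }
  have hA : ∀ a, A a = ρ • ∑ i, a i • x i := fun a => rfl
  let M : Matrix (Fin m) (Fin m) ℝ := Matrix.of fun i j => K⁻¹ * ρ * g i (x j)
  let T := Matrix.toEuclideanLin M
  have hTA : ∀ a i, T a i = K⁻¹ * g i (A a) := fun a i => by
    simp only [T, M, Matrix.toLpLin_apply, Matrix.mulVec, dotProduct, Matrix.of_apply, hA,
      map_smul, map_sum, smul_eq_mul, Finset.mul_sum]
    exact Finset.sum_congr rfl fun j _ => by ring
  have hT : ∀ a, ‖T a‖ ≤ ‖S (A a)‖ := fun a => by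
    refine le_of_sq_le_sq ?_ (norm_nonneg _)
    rw [EuclideanSpace.real_norm_sq_eq]
    simp_rw [hTA, mul_pow]
    rw [← Finset.mul_sum, inv_pow, inv_mul_le_iff₀ (by positivity)]
    exact hgK _
  have hdet : (ρ * η / K) ^ m ≤ ∏ i ∈ Finset.range m, T.singularValues i := by
    have htriM : M.BlockTriangular OrderDual.toDual := fun i j hij => by
      simp [M, htri i j hij]
    rw [← abs_det_eq_prod_singularValues, Matrix.det_of_isLowerTriangular M htriM, Finset.abs_prod]
    calc (ρ * η / K) ^ m = ∏ _i : Fin m, (ρ * η / K) := by simp [div_pow]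
      _ ≤ _ := Finset.prod_le_prod (fun i _ => by positivity) fun i _ => by
          simp only [M, Matrix.of_apply]
          rw [abs_mul, abs_of_pos (by positivity : 0 < K⁻¹ * ρ)]
          calc ρ * η / K = K⁻¹ * ρ * η := by ring
            _ ≤ _ := mul_le_mul_of_nonneg_left (hdiag i) (by positivity)
  have hprod : (ρ * η / K) ^ n ≤
      ∏ k ∈ Finset.range n, T.singularValues (2 * realDim 𝕜 * k - (realDim 𝕜 - 1)) :=
    pow_le_prod_of_pow_le_prod T.singularValues_antitone T.singularValues_nonneg hκ hn
      (by positivity) (by rwa [← hm])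
  have herr : ∀ k ∈ Finset.range n,
      ENNReal.ofReal (T.singularValues (2 * realDim 𝕜 * k - (realDim 𝕜 - 1)) / 256)
        ≤ minError.{w} cls k S F := by
    intro k hk
    rw [Finset.mem_range] at hk
    obtain ⟨r, hr, hkr, hqr⟩ : ∃ r, 0 < r ∧ realDim 𝕜 * k ≤ r ∧
        2 * realDim 𝕜 * k - (realDim 𝕜 - 1) + 1 = realDim 𝕜 * k + r := by
      refine ⟨2 * realDim 𝕜 * k - (realDim 𝕜 - 1) + 1 - realDim 𝕜 * k, ?_⟩
      rcases hκ with h | h <;> rw [h] <;> omega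
    have hqm : 2 * realDim 𝕜 * k - (realDim 𝕜 - 1) + 1 ≤ m := by
      rw [hm]
      rcases hκ with h | h <;> rw [h] <;> omega
    obtain ⟨J, hJ, hTJ⟩ := exists_isometry_singularValues_mul_le T (finrank_euclideanSpace_fin)
      hqm (T.singularValues_nonneg _)
      fun i hi => T.singularValues_antitone (Nat.lt_succ_iff.1 hi)
    refine ofReal_le_minError hF (z := z) (A := A ∘ₗ J) (fun a ha => ?_) (fun a => ?_) hr hkr
      (finrank_euclideanSpace_fin.trans hqr) cls
    · exact hz _ (by rwa [hJ])
    · exact (hTJ a).trans (hT _)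
  rw [geomMeanError, one_div]
  rw [ENNReal.le_rpow_inv_iff (by exact_mod_cast hn), ENNReal.rpow_natCast]
  calc ENNReal.ofReal (ρ * η / K / 256) ^ n
      = ENNReal.ofReal ((ρ * η / K) ^ n * (1 / 256) ^ n) := by
        rw [← ENNReal.ofReal_pow (by positivity), ← mul_pow]
        congr 2
        ring
    _ ≤ ENNReal.ofReal ((∏ k ∈ Finset.range n,
          T.singularValues (2 * realDim 𝕜 * k - (realDim 𝕜 - 1))) * (1 / 256) ^ n) :=
        ENNReal.ofReal_le_ofReal (mul_le_mul_of_nonneg_right hprod (by positivity))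
    _ = ∏ k ∈ Finset.range n,
          ENNReal.ofReal (T.singularValues (2 * realDim 𝕜 * k - (realDim 𝕜 - 1)) / 256) := by
        rw [← ENNReal.ofReal_prod_of_nonneg
          fun k _ => div_nonneg (T.singularValues_nonneg _) (by norm_num), Finset.prod_div_distrib]
        simp [div_eq_mul_inv]
    _ ≤ _ := Finset.prod_le_prod' herr

end Triangular

theorem exists_fin_seq {α : Type*} (P : ℕ → α → Prop) (r : α → α → Prop) (N : ℕ)
    (h : ∀ k < N, ∀ f : Fin k → α, (∀ i : Fin k, P i (f i)) → ∃ y, P k y ∧ ∀ i, r (f i) y) :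
    ∃ f : Fin N → α, (∀ i : Fin N, P i (f i)) ∧ ∀ i j, i < j → r (f i) (f j) := by
  induction N with
  | zero => exact ⟨Fin.elim0, fun i => i.elim0, fun i => i.elim0⟩
  | succ N ih =>
    obtain ⟨f, hf, hr⟩ := ih fun k hk => h k (by omega)
    obtain ⟨y, hy, hfy⟩ := h N (by omega) f hf
    refine ⟨Fin.snoc (α := fun _ => α) f y, fun i => ?_, fun i j hij => ?_⟩
    · refine Fin.lastCases ?_ (fun i => ?_) i
      · simpa using hy
      · simpa using hf i
    · induction j using Fin.lastCases with
      | last =>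
        induction i using Fin.lastCases with
        | last => exact absurd hij (lt_irrefl _)
        | cast i => simpa using hfy i
      | cast j =>
        induction i using Fin.lastCases with
        | last => exact absurd hij (not_lt.2 (Fin.le_last _))
        | cast i => simpa using hr i j (by simpa using hij)

section RealOrthogonal

variable {𝕜 V : Type*} [RCLike 𝕜] [NormedAddCommGroup V] [InnerProductSpace 𝕜 V] {m : ℕ}

theorem norm_sq_sum_of_re_inner_eq_zero {v : Fin m → V}
    (hv : ∀ i j, i < j → RCLike.re (inner 𝕜 (v i) (v j)) = 0) (a : Fin m → ℝ) :
    ‖∑ i, (a i : 𝕜) • v i‖ ^ 2 = ∑ i, a i ^ 2 * ‖v i‖ ^ 2 := by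
  have hv' : ∀ i j, i ≠ j → RCLike.re (inner 𝕜 (v i) (v j)) = 0 := fun i j hij => by
    rcases lt_or_gt_of_ne hij with h | h
    · exact hv i j h
    · rw [inner_re_symm]
      exact hv j i h
  rw [← inner_self_eq_norm_sq (𝕜 := 𝕜), sum_inner, map_sum]
  refine Finset.sum_congr rfl fun i _ => ?_
  rw [inner_sum, map_sum, Finset.sum_eq_single i]
  · rw [inner_smul_left, inner_smul_right, RCLike.conj_ofReal, RCLike.re_ofReal_mul,
      RCLike.re_ofReal_mul, inner_self_eq_norm_sq]
    ring
  · intro j _ hj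
    rw [inner_smul_left, inner_smul_right, RCLike.conj_ofReal, RCLike.re_ofReal_mul,
      RCLike.re_ofReal_mul, hv' i j hj.symm]
    ring
  · simp

theorem sum_re_inner_sq_le {v : Fin m → V}
    (hv : ∀ i j, i < j → RCLike.re (inner 𝕜 (v i) (v j)) = 0) (hv1 : ∀ i, ‖v i‖ ≤ 1) (y : V) :
    ∑ i, RCLike.re (inner 𝕜 (v i) y) ^ 2 ≤ ‖y‖ ^ 2 := by
  set Q := ∑ i, RCLike.re (inner 𝕜 (v i) y) ^ 2 with hQ
  have hQ0 : 0 ≤ Q := Finset.sum_nonneg fun i _ => sq_nonneg _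
  set u := ∑ i, ((RCLike.re (inner 𝕜 (v i) y) : ℝ) : 𝕜) • v i with hu
  have h1 : ‖u‖ ^ 2 ≤ Q := by
    rw [hu, norm_sq_sum_of_re_inner_eq_zero hv]
    refine Finset.sum_le_sum fun i _ => ?_
    have := pow_le_one₀ (n := 2) (norm_nonneg _) (hv1 i)
    exact mul_le_of_le_one_right (sq_nonneg _) this
  have h2 : RCLike.re (inner 𝕜 u y) = Q := by
    rw [hu, sum_inner, map_sum]
    refine Finset.sum_congr rfl fun i _ => ?_
    rw [inner_smul_left, RCLike.conj_ofReal, RCLike.re_ofReal_mul, sq]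
  have h3 : Q ≤ ‖u‖ * ‖y‖ := h2 ▸ re_inner_le_norm u y
  rcases hQ0.eq_or_lt with h0 | h0
  · rw [← h0]
    positivity
  · have h4 : Q ^ 2 ≤ Q * ‖y‖ ^ 2 := by
      calc Q ^ 2 ≤ (‖u‖ * ‖y‖) ^ 2 := pow_le_pow_left₀ hQ0 h3 2
        _ = ‖u‖ ^ 2 * ‖y‖ ^ 2 := mul_pow _ _ _
        _ ≤ Q * ‖y‖ ^ 2 := mul_le_mul_of_nonneg_right h1 (sq_nonneg _)
    rw [sq Q] at h4
    exact le_of_mul_le_mul_left h4 h0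

end RealOrthogonal

section Cube

variable {V : Type*} [AddCommGroup V] [Module ℝ V] {F : Set V} {m : ℕ}

theorem abs_apply_le_norm (x : EuclideanSpace ℝ (Fin m)) (i : Fin m) : |x i| ≤ ‖x‖ :=
  PiLp.norm_apply_le x i

theorem exists_center_add_sum_mem (hF : Convex ℝ F) (hm : 0 < m) {x : Fin m → V}
    (hx : ∀ i, x i ∈ F - F) {ρ : ℝ} (hρ : 0 ≤ ρ) (hρm : ρ * (2 * m) ≤ 1) :
    ∃ z, ∀ u : EuclideanSpace ℝ (Fin m), ‖u‖ ≤ 1 → z + ρ • ∑ i, u i • x i ∈ F := by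
  choose f hf g hg hfg using hx
  have hm' : (0 : ℝ) < m := by exact_mod_cast hm
  refine ⟨∑ i, (2 * m : ℝ)⁻¹ • (f i + g i), fun u hu => ?_⟩
  have hc : ∀ i, |ρ * (2 * m) * u i| ≤ 1 := fun i => by
    rw [abs_mul, abs_of_nonneg (by positivity)]
    exact mul_le_one₀ hρm (abs_nonneg _) ((abs_apply_le_norm u i).trans hu)
  have key : ∑ i, (2 * m : ℝ)⁻¹ • (f i + g i) + ρ • ∑ i, u i • x i
      = ∑ i, (m : ℝ)⁻¹ • (((1 + ρ * (2 * m) * u i) / 2) • f i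
        + ((1 - ρ * (2 * m) * u i) / 2) • g i) := by
    rw [Finset.smul_sum, ← Finset.sum_add_distrib]
    refine Finset.sum_congr rfl fun i _ => ?_
    rw [← hfg]
    match_scalars <;> field_simp <;> ring
  rw [key]
  refine hF.sum_mem (fun i _ => by positivity) (by simp [hm'.ne']) fun i _ => ?_
  have := abs_le.1 (hc i)
  exact hF (hf i) (hg i) (by linarith) (by linarith) (by ring)

theorem sum_smul_mem_of_symm (hF : Convex ℝ F) (hs : ∀ f ∈ F, -f ∈ F) (h0 : (0 : V) ∈ F)
    {y : Fin m → V} (hy : ∀ i, y i ∈ F) {u : Fin m → ℝ} (hu : ∑ i, |u i| ≤ 1) :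
    ∑ i, u i • y i ∈ F := by
  set σ := ∑ i, |u i| with hσ
  rcases (Finset.sum_nonneg fun i _ => abs_nonneg (u i) : 0 ≤ σ).eq_or_lt with h | h
  · have hz : ∀ i, u i = 0 := fun i => by
      have := (Finset.sum_eq_zero_iff_of_nonneg fun i _ => abs_nonneg (u i)).1 h.symm i
        (Finset.mem_univ i)
      simpa using this
    simpa [hz] using h0
  · have key : ∑ i, u i • y i = σ • ∑ i, (|u i| / σ) • ((SignType.sign (u i) : ℝ) • y i) := by
      rw [Finset.smul_sum]
      refine Finset.sum_congr rfl fun i _ => ?_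
      rw [smul_smul, smul_smul, mul_div_cancel₀ _ h.ne', abs_mul_sign]
    rw [key]
    refine hF.smul_mem_of_zero_mem h0 (hF.sum_mem (fun i _ => by positivity) ?_ fun i _ => ?_)
      ⟨h.le, hu⟩
    · rw [← Finset.sum_div, ← hσ, div_self h.ne']
    · rcases lt_trichotomy (u i) 0 with h | h | h
      · simpa [sign_neg h] using hs _ (hy i)
      · simpa [h] using h0
      · simpa [sign_pos h] using hy i

theorem smul_sum_mem_of_symm (hF : Convex ℝ F) (hs : ∀ f ∈ F, -f ∈ F) (h0 : (0 : V) ∈ F)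
    {x : Fin m → V} (hx : ∀ i, x i ∈ F - F) {ρ : ℝ} (hρ : 0 ≤ ρ) (hρm : ρ * (2 * √m) ≤ 1)
    (u : EuclideanSpace ℝ (Fin m)) (hu : ‖u‖ ≤ 1) : 0 + ρ • ∑ i, u i • x i ∈ F := by
  have hy : ∀ i, (1 / 2 : ℝ) • x i ∈ F := fun i => by
    obtain ⟨f, hf, g, hg, hfg⟩ := hx i
    have := hF hf (hs g hg) (a := 1 / 2) (b := 1 / 2) (by norm_num) (by norm_num) (by norm_num)
    rwa [← smul_add, ← sub_eq_add_neg, show f - g = x i from hfg] at this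
  have key : 0 + ρ • ∑ i, u i • x i = ∑ i, (2 * ρ * u i) • ((1 / 2 : ℝ) • x i) := by
    rw [zero_add, Finset.smul_sum]
    refine Finset.sum_congr rfl fun i _ => ?_
    rw [smul_smul, smul_smul]
    congr 1
    ring
  rw [key]
  refine sum_smul_mem_of_symm hF hs h0 hy ?_
  have h1 : ∑ i, |u i| ≤ √m := by
    refine Real.le_sqrt_of_sq_le ?_
    have h2 := sq_sum_le_card_mul_sum_sq (s := (Finset.univ : Finset (Fin m)))
      (f := fun i => |u i|)
    simp only [sq_abs, Finset.card_univ, Fintype.card_fin] at h2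
    rw [← EuclideanSpace.real_norm_sq_eq] at h2
    refine h2.trans (mul_le_of_le_one_right (Nat.cast_nonneg _) ?_)
    exact pow_le_one₀ (norm_nonneg _) hu
  calc ∑ i, |2 * ρ * u i| = 2 * ρ * ∑ i, |u i| := by
        rw [Finset.mul_sum]
        refine Finset.sum_congr rfl fun i _ => ?_
        rw [abs_mul, abs_of_nonneg (by positivity)]
    _ ≤ 2 * ρ * √m := by gcongr
    _ ≤ 1 := by linarith

end Cube

section Systems

variable {𝕜 : Type a} {X : Type b} {Y : Type c} [RCLike 𝕜]
  [NormedAddCommGroup X] [NormedSpace 𝕜 X]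
  [NormedAddCommGroup Y] [NormedSpace 𝕜 Y]

/-- No `p` measurements determine the solution on `F` up to diameter less than `δ`. -/
def HasWidth (p : ℕ) (S : X →L[𝕜] Y) (F : Set X) (δ : ℝ) : Prop :=
  ∀ L : Fin p → (X →L[𝕜] 𝕜), ∃ x ∈ F - F, (∀ i, L i x = 0) ∧ δ ≤ ‖S x‖

theorem HasWidth.exists_of_card_le {p : ℕ} {S : X →L[𝕜] Y} {F : Set X} {δ : ℝ}
    (h : HasWidth p S F δ) {ι : Type*} [Fintype ι] (hι : Fintype.card ι ≤ p)
    (L : ι → (X →L[𝕜] 𝕜)) : ∃ x ∈ F - F, (∀ i, L i x = 0) ∧ δ ≤ ‖S x‖ := by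
  obtain ⟨e⟩ : Nonempty (ι ↪ Fin p) :=
    Function.Embedding.nonempty_of_card_le (by simpa using hι)
  obtain ⟨x, hx, hL, hS⟩ := h (Function.extend e L 0)
  refine ⟨x, hx, fun i => ?_, hS⟩
  have := hL (e i)
  rwa [e.injective.extend_apply] at this

/-- Pairs of vectors and functionals that form a block triangular system. -/
structure BlockSystem (N : ℕ) (S : X →L[𝕜] Y) (D : Set X) (η : ℝ) where
  /-- the first vectors of the pairs -/
  fst : Fin N → X
  /-- the second vectors of the pairs -/
  snd : Fin N → X
  /-- the functionals -/
  dual : Fin N → (Y →L[𝕜] 𝕜)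
  fst_mem : ∀ j, fst j ∈ D
  snd_mem : ∀ j, snd j ∈ D
  norm_dual_le : ∀ j, ‖dual j‖ ≤ 1
  dual_fst : ∀ i j, i < j → dual i (S (fst j)) = 0
  dual_snd : ∀ i j, i < j → dual i (S (snd j)) = 0
  le_re : ∀ j, η ≤ RCLike.re (dual j (S (fst j)))
  re_snd : ∀ j : Fin N, (j : ℕ) + 1 < N → RCLike.re (dual j (S (snd j))) = 0
  le_im : ∀ j : Fin N, (j : ℕ) + 1 < N → RCLike.im (RCLike.I : 𝕜) = 1 →
    η ≤ |RCLike.im (dual j (S (snd j)))|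

theorem exists_index (𝕜 : Type*) [RCLike 𝕜] {n : ℕ} (hn : 1 ≤ n) :
    ∃ σ : Fin (2 * realDim 𝕜 * n - (realDim 𝕜 - 1)) → Fin (2 * n) × Bool,
      (∀ i j, i < j → (σ i).1 < (σ j).1 ∨
        ((σ i).1 = (σ j).1 ∧ (σ i).2 = false ∧ (σ j).2 = true)) ∧
      ∀ i, (σ i).2 = true → ((σ i).1 : ℕ) + 1 < 2 * n ∧ RCLike.im (RCLike.I : 𝕜) = 1 := by
  by_cases hI : (RCLike.I : 𝕜) = 0
  · have hκ : realDim 𝕜 = 1 := if_pos hI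
    rw [hκ]
    exact ⟨fun i => (⟨i, by omega⟩, false), fun i j hij => Or.inl hij, by simp⟩
  · have hκ : realDim 𝕜 = 2 := if_neg hI
    have him : RCLike.im (RCLike.I : 𝕜) = 1 := (RCLike.I_eq_zero_or_im_I_eq_one).resolve_left hI
    rw [hκ]
    refine ⟨fun i => (⟨i / 2, by omega⟩, decide ((i : ℕ) % 2 = 1)), fun i j hij => ?_,
      fun i hi => ⟨?_, him⟩⟩
    · simp only [Fin.mk_lt_mk, Fin.mk.injEq, decide_eq_false_iff_not, decide_eq_true_eq]
      have : (i : ℕ) < j := hij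
      omega
    · simp only [decide_eq_true_eq] at hi
      simp only
      omega

theorem RCLike.re_neg_I_mul (z : 𝕜) :
    RCLike.re (-RCLike.I * z) = RCLike.im (RCLike.I : 𝕜) * RCLike.im z := by
  simp

theorem norm_I_le_one : ‖(RCLike.I : 𝕜)‖ ≤ 1 := by
  rw [RCLike.norm_I]
  split_ifs <;> simp

namespace BlockSystem

variable {n : ℕ} {S : X →L[𝕜] Y} {D : Set X} {η : ℝ} (B : BlockSystem (2 * n) S D η)

/-- The vector of a block system with a given index. -/
def vec (q : Fin (2 * n) × Bool) : X := if q.2 then B.snd q.1 else B.fst q.1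

/-- The functional of a block system whose real part belongs to a given index. -/
noncomputable def functional (q : Fin (2 * n) × Bool) : Y →L[𝕜] 𝕜 :=
  if q.2 then (-RCLike.I : 𝕜) • B.dual q.1 else B.dual q.1

theorem vec_mem (q : Fin (2 * n) × Bool) : B.vec q ∈ D := by
  unfold vec
  split_ifs
  exacts [B.snd_mem _, B.fst_mem _]

theorem norm_functional_le (q : Fin (2 * n) × Bool) : ‖B.functional q‖ ≤ 1 := by
  unfold functional
  split_ifs
  · rw [norm_smul, norm_neg]
    exact mul_le_one₀ norm_I_le_one (norm_nonneg _) (B.norm_dual_le _)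
  · exact B.norm_dual_le _

variable {B} in
theorem dual_vec_eq_zero {i j : Fin (2 * n) × Bool} (h : i.1 < j.1) :
    B.dual i.1 (S (B.vec j)) = 0 := by
  unfold vec
  split_ifs
  exacts [B.dual_snd _ _ h, B.dual_fst _ _ h]

theorem re_functional_vec_eq_zero {i j : Fin (2 * n) × Bool}
    (h : i.1 < j.1 ∨ (i.1 = j.1 ∧ i.2 = false ∧ j.2 = true))
    (hj : j.2 = true → (j.1 : ℕ) + 1 < 2 * n) :
    RCLike.re (B.functional i (S (B.vec j))) = 0 := by
  rcases h with h | ⟨h1, h2, h3⟩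
  · unfold functional
    split_ifs <;> simp [dual_vec_eq_zero h]
  · simp only [functional, vec, h2, h3, if_true, h1]
    exact B.re_snd _ (hj h3)

theorem le_abs_re_functional_vec {i : Fin (2 * n) × Bool}
    (h : i.2 = true → (i.1 : ℕ) + 1 < 2 * n ∧ RCLike.im (RCLike.I : 𝕜) = 1) :
    η ≤ |RCLike.re (B.functional i (S (B.vec i)))| := by
  rcases hi : i.2 with _ | _
  · simp only [functional, vec, hi]
    exact (B.le_re _).trans (le_abs_self _)
  · obtain ⟨h1, h2⟩ := h hi
    simp only [functional, vec, hi, if_true, smul_apply, smul_eq_mul,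
      RCLike.re_neg_I_mul, h2, one_mul]
    exact B.le_im _ h1 h2

end BlockSystem

theorem BlockSystem.ofReal_le_geomMeanError [NormedSpace ℝ X] [IsScalarTower ℝ 𝕜 X] {n : ℕ}
    {S : X →L[𝕜] Y} {F D : Set X} {η : ℝ} (B : BlockSystem (2 * n) S D η)
    (hF : Convex ℝ F) (hn : 1 ≤ n) {K ρ : ℝ} (hη : 0 < η) (hK : 0 < K) (hρ : 0 < ρ)
    {σ : Fin (2 * realDim 𝕜 * n - (realDim 𝕜 - 1)) → Fin (2 * n) × Bool}
    (hσ : ∀ i j, i < j → (σ i).1 < (σ j).1 ∨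
        ((σ i).1 = (σ j).1 ∧ (σ i).2 = false ∧ (σ j).2 = true))
    (hσ' : ∀ i, (σ i).2 = true → ((σ i).1 : ℕ) + 1 < 2 * n ∧ RCLike.im (RCLike.I : 𝕜) = 1)
    (hBK : ∀ y, ∑ i, RCLike.re (B.functional (σ i) y) ^ 2 ≤ K ^ 2 * ‖y‖ ^ 2) {z : X}
    (hz : ∀ u : EuclideanSpace ℝ (Fin _), ‖u‖ ≤ 1 → z + ρ • ∑ i, u i • B.vec (σ i) ∈ F)
    (cls : AlgClass) :
    ENNReal.ofReal (ρ * η / K / 256) ≤ geomMeanError.{w} cls n S F :=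
  _root_.ofReal_le_geomMeanError hF hn rfl (x := fun i => B.vec (σ i))
    (g := fun i => reFunctional ((B.functional (σ i)).comp S))
    (fun i j hij => B.re_functional_vec_eq_zero (hσ i j hij) fun h => (hσ' j h).1) hη hK hρ
    (fun i => B.le_abs_re_functional_vec (hσ' i)) (fun y => hBK (S y)) hz cls

/-- A choice of norming functionals. -/
def IsNorming (nf : Y → (Y →L[𝕜] 𝕜)) : Prop := ∀ y, ‖nf y‖ ≤ 1 ∧ nf y y = ‖y‖

theorem exists_isNorming : ∃ nf : Y → (Y →L[𝕜] 𝕜), IsNorming nf := by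
  choose nf h using fun y : Y => exists_dual_vector'' 𝕜 y
  exact ⟨nf, h⟩

theorem exists_blockSystem {nf : Y → (Y →L[𝕜] 𝕜)} (hnf : IsNorming nf) {S : X →L[𝕜] Y}
    {F : Set X} {δ : ℝ} {N : ℕ} (hw : HasWidth (N - 1) S F δ) :
    ∃ (B : BlockSystem N S (F - F) (δ / 2)) (t : Fin N → ℝ), ∀ j, |t j| ≤ 1 ∧
      B.dual j = (2⁻¹ : 𝕜) • (nf (S (B.fst j)) + ((t j : 𝕜) * RCLike.I) • nf (S (B.snd j))) := by
  let dual : X × X × ℝ → (Y →L[𝕜] 𝕜) := fun q =>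
    (2⁻¹ : 𝕜) • (nf (S q.1) + ((q.2.2 : 𝕜) * RCLike.I) • nf (S q.2.1))
  obtain ⟨f, hP, hr⟩ := exists_fin_seq
    (fun k (q : X × X × ℝ) => q.1 ∈ F - F ∧ q.2.1 ∈ F - F ∧ |q.2.2| ≤ 1 ∧
      δ / 2 ≤ RCLike.re (dual q (S q.1)) ∧
      (k + 1 < N → RCLike.re (dual q (S q.2.1)) = 0 ∧
        (RCLike.im (RCLike.I : 𝕜) = 1 → δ / 2 ≤ |RCLike.im (dual q (S q.2.1))|)))
    (fun q q' => dual q (S q'.1) = 0 ∧ dual q (S q'.2.1) = 0) N (by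
      intro k hk f _
      obtain ⟨x, hx, hLx, hSx⟩ := hw.exists_of_card_le (ι := Fin k) (by simp; omega)
        fun i => (dual (f i)).comp S
      have h2 : (2⁻¹ : 𝕜) = ((2⁻¹ : ℝ) : 𝕜) := by
        rw [RCLike.ofReal_inv, RCLike.ofReal_ofNat]
      by_cases hk1 : k + 1 < N
      · obtain ⟨x', hx', hLx', hSx'⟩ := hw.exists_of_card_le (ι := Option (Fin k))
          (by simp; omega)
          fun i => i.elim ((nf (S x)).comp S) fun i => (dual (f i)).comp S
        have hx0 : nf (S x) (S x') = 0 := hLx' none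
        set s := RCLike.im (nf (S x') (S x)) with hs
        obtain ⟨t, ht, hts⟩ : ∃ t : ℝ, |t| = 1 ∧ t * s ≤ 0 := by
          rcases le_total s 0 with h | h
          · exact ⟨1, by simp, by linarith⟩
          · exact ⟨-1, by simp, by linarith⟩
        refine ⟨(x, x', t), ⟨hx, hx', ht.le, ?_, fun _ => ⟨?_, fun hI => ?_⟩⟩,
          fun i => ⟨hLx i, hLx' (some i)⟩⟩
        · have hI0 : 0 ≤ RCLike.im (RCLike.I : 𝕜) := by
            rcases RCLike.I_eq_zero_or_im_I_eq_one (K := 𝕜) with h | h <;> simp [h]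
          have hI1 : RCLike.re (RCLike.I * nf (S x') (S x)) = -(RCLike.im (RCLike.I : 𝕜) * s) := by
            rw [RCLike.mul_re, RCLike.I_re, zero_mul, zero_sub]
          simp only [dual, smul_apply, add_apply, smul_eq_mul, (hnf (S x)).2, h2,
            RCLike.re_ofReal_mul, map_add, RCLike.ofReal_re, mul_assoc, hI1]
          nlinarith
        · simp only [dual, smul_apply, add_apply,
            smul_eq_mul, (hnf (S x')).2, h2, RCLike.re_ofReal_mul, map_add, hx0, mul_assoc]
          simp
        · simp only [dual, smul_apply, add_apply,
            smul_eq_mul, (hnf (S x')).2, h2, RCLike.im_ofReal_mul, hx0, mul_assoc,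
            zero_add, RCLike.im_mul_ofReal, hI, one_mul, abs_mul, ht, abs_norm]
          rw [abs_of_pos (by norm_num)]
          linarith
      · refine ⟨(x, x, 0), ⟨hx, hx, by simp, ?_, fun h => absurd h hk1⟩,
          fun i => ⟨hLx i, hLx i⟩⟩
        simp only [dual, smul_apply, add_apply,
            smul_eq_mul, (hnf (S x)).2, h2, RCLike.re_ofReal_mul, map_add, RCLike.ofReal_re]
        simp
        linarith)
  refine ⟨⟨fun j => (f j).1, fun j => (f j).2.1, fun j => dual (f j), fun j => (hP j).1,
    fun j => (hP j).2.1, fun j => ?_, fun i j hij => (hr i j hij).1, fun i j hij => (hr i j hij).2,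
    fun j => (hP j).2.2.2.1, fun j hj => ((hP j).2.2.2.2 hj).1,
    fun j hj => ((hP j).2.2.2.2 hj).2⟩, fun j => (f j).2.2, fun j => ⟨(hP j).2.2.1, rfl⟩⟩
  simp only [dual]
  rw [norm_smul, norm_inv, RCLike.norm_two]
  have h1 := (hnf (S (f j).1)).1
  have h2 : ‖(((f j).2.2 : 𝕜) * RCLike.I) • nf (S (f j).2.1)‖ ≤ 1 := by
    rw [norm_smul, norm_mul, RCLike.norm_ofReal]
    exact mul_le_one₀ (mul_le_one₀ (hP j).2.2.1 (norm_nonneg _) norm_I_le_one)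
      (norm_nonneg _) (hnf _).1
  have := norm_add_le (nf (S (f j).1)) ((((f j).2.2 : 𝕜) * RCLike.I) • nf (S (f j).2.1))
  linarith

end Systems

theorem index_card_le (𝕜 : Type*) [RCLike 𝕜] (n : ℕ) :
    2 * realDim 𝕜 * n - (realDim 𝕜 - 1) ≤ 4 * n := by
  have hκ : realDim 𝕜 = 1 ∨ realDim 𝕜 = 2 := by
    unfold realDim
    split_ifs <;> simp
  rcases hκ with h | h <;> rw [h] <;> omega

theorem index_card_pos (𝕜 : Type*) [RCLike 𝕜] {n : ℕ} (hn : 1 ≤ n) :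
    0 < 2 * realDim 𝕜 * n - (realDim 𝕜 - 1) := by
  have hκ : realDim 𝕜 = 1 ∨ realDim 𝕜 = 2 := by
    unfold realDim
    split_ifs <;> simp
  rcases hκ with h | h <;> rw [h] <;> omega

section BanachTarget

variable {𝕜 : Type a} {X : Type b} {Y : Type c} [RCLike 𝕜]
  [NormedAddCommGroup X] [NormedSpace 𝕜 X]
  [NormedAddCommGroup Y] [NormedSpace 𝕜 Y]

theorem minError_le_of_width [NormedSpace ℝ X] [IsScalarTower ℝ 𝕜 X] {S : X →L[𝕜] Y} {F : Set X}
    (hF : Convex ℝ F) (hb : Bornology.IsBounded F) {p n : ℕ} (hn : 1 ≤ n) {r : ℝ} (hr : 0 ≤ r)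
    {G : ℝ≥0∞}
    (h : ∀ δ > 0, HasWidth p S F δ → ENNReal.ofReal (δ / (8192 * (n : ℝ) ^ r)) ≤ G)
    (cls : AlgClass) :
    minError.{w} cls p S F ≤ ((8192 : ℝ≥0) : ℝ≥0∞) * (n : ℝ≥0∞) ^ r * G := by
  set c : ℝ := 8192 * (n : ℝ) ^ r with hc
  have hn0 : (0 : ℝ) < n := by exact_mod_cast hn
  have hc0 : 0 < c := by positivity
  have hcc : ((8192 : ℝ≥0) : ℝ≥0∞) * (n : ℝ≥0∞) ^ r = ENNReal.ofReal c := by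
    rw [hc, ENNReal.ofReal_mul (by norm_num), ← ENNReal.ofReal_rpow_of_nonneg hn0.le hr,
      ENNReal.ofReal_natCast]
    norm_num
  rw [hcc]
  rcases eq_or_ne G ∞ with rfl | hG
  · rw [ENNReal.mul_top (by simpa using hc0)]
    exact le_top
  refine ENNReal.le_of_forall_pos_le_add fun ε hε _ => ?_
  have hε' : (0 : ℝ) < ε := hε
  set δ : ℝ := c * G.toReal + ε with hδ
  have hδ0 : 0 < δ := by positivity
  have hnot : ¬ HasWidth p S F δ := fun hw => by
    have h1 := h δ hδ0 hw
    rw [ENNReal.ofReal_le_iff_le_toReal hG, div_le_iff₀ hc0] at h1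
    linarith
  unfold HasWidth at hnot
  push Not at hnot
  obtain ⟨L, hL⟩ := hnot
  refine (minError_le_of_kernel hF hb L hδ0.le (fun x hx hLx => (hL x hx hLx).le) cls).trans
    (le_of_eq ?_)
  rw [hδ, ENNReal.ofReal_add (by positivity) hε'.le, ENNReal.ofReal_mul hc0.le,
    ENNReal.ofReal_toReal hG, ENNReal.ofReal_coe_nnreal]

theorem sum_re_functional_sq_le {n m : ℕ} (hm : m ≤ 4 * n) {S : X →L[𝕜] Y} {D : Set X} {η : ℝ}
    (B : BlockSystem (2 * n) S D η) (σ : Fin m → Fin (2 * n) × Bool) (y : Y) :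
    ∑ i, RCLike.re (B.functional (σ i) y) ^ 2 ≤ (2 * √n) ^ 2 * ‖y‖ ^ 2 := by
  calc ∑ i, RCLike.re (B.functional (σ i) y) ^ 2 ≤ ∑ _i : Fin m, ‖y‖ ^ 2 := by
        refine Finset.sum_le_sum fun i _ => ?_
        rw [← sq_abs]
        refine pow_le_pow_left₀ (abs_nonneg _) ((RCLike.abs_re_le_norm _).trans ?_) 2
        exact ((B.functional (σ i)).le_opNorm y).trans
          (mul_le_of_le_one_left (norm_nonneg _) (B.norm_functional_le _))
    _ = m * ‖y‖ ^ 2 := by simp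
    _ ≤ (2 * √n) ^ 2 * ‖y‖ ^ 2 := by
        rw [mul_pow, Real.sq_sqrt (Nat.cast_nonneg n)]
        refine mul_le_mul_of_nonneg_right ?_ (sq_nonneg _)
        have : (m : ℝ) ≤ 4 * n := by exact_mod_cast hm
        linarith

/-- The bounds for arbitrary and for symmetric classes, given the norm `2 * β` of the map that is
formed by the functionals. -/
theorem ofReal_le_geomMeanError_of_blockSystem [NormedSpace ℝ X] [IsScalarTower ℝ 𝕜 X] {n : ℕ}
    (hn : 1 ≤ n) {S : X →L[𝕜] Y} {F : Set X} (hF : Convex ℝ F) {δ β : ℝ} (hδ : 0 < δ) (hβ : 0 < β)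
    (B : BlockSystem (2 * n) S (F - F) (δ / 2))
    (hBK : ∀ σ : Fin (2 * realDim 𝕜 * n - (realDim 𝕜 - 1)) → Fin (2 * n) × Bool,
      (∀ i j, i < j → (σ i).1 < (σ j).1 ∨
        ((σ i).1 = (σ j).1 ∧ (σ i).2 = false ∧ (σ j).2 = true)) →
      ∀ y, ∑ i, RCLike.re (B.functional (σ i) y) ^ 2 ≤ (2 * β) ^ 2 * ‖y‖ ^ 2)
    (cls : AlgClass) :
    ENNReal.ofReal (δ / (8192 * (n * β))) ≤ geomMeanError.{w} cls n S F ∧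
      ((∀ f ∈ F, -f ∈ F) →
        ENNReal.ofReal (δ / (8192 * (√n * β))) ≤ geomMeanError.{w} cls n S F) := by
  have hn0 : (0 : ℝ) < n := by exact_mod_cast hn
  obtain ⟨σ, hσ, hσ'⟩ := exists_index 𝕜 hn
  have hm0 := index_card_pos 𝕜 hn
  have hm4 : ((2 * realDim 𝕜 * n - (realDim 𝕜 - 1) : ℕ) : ℝ) ≤ 4 * n := by
    exact_mod_cast index_card_le 𝕜 n
  constructor
  · obtain ⟨z, hz⟩ := exists_center_add_sum_mem hF hm0 (fun i => B.vec_mem (σ i))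
      (ρ := (8 * (n : ℝ))⁻¹) (by positivity) (by
        rw [inv_mul_le_iff₀ (by positivity)]
        linarith)
    have := B.ofReal_le_geomMeanError.{w} hF hn (by positivity) (by positivity) (by positivity)
      hσ hσ' (hBK σ hσ) hz cls
    convert this using 2
    field_simp
    norm_num
  · intro hs
    have h0 : (0 : X) ∈ F := by
      obtain ⟨f, hf, -⟩ := B.fst_mem ⟨0, by omega⟩
      have := hF hf (hs f hf) (a := 1 / 2) (b := 1 / 2) (by norm_num) (by norm_num) (by norm_num)
      simpa using this
    have hz := smul_sum_mem_of_symm hF hs h0 (fun i => B.vec_mem (σ i)) (ρ := (8 * √n)⁻¹)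
      (by positivity) (by
        rw [inv_mul_le_iff₀ (by positivity), mul_one]
        have h1 := Real.sqrt_le_sqrt hm4
        have h2 : √(4 * (n : ℝ)) = 2 * √n := by
          rw [Real.sqrt_mul (by norm_num), show (4 : ℝ) = 2 ^ 2 by norm_num,
            Real.sqrt_sq (by norm_num)]
        have := Real.sqrt_nonneg (n : ℝ)
        linarith)
    have := B.ofReal_le_geomMeanError.{w} hF hn (by positivity) (by positivity) (by positivity)
      hσ hσ' (hBK σ hσ) hz cls
    convert this using 2
    field_simp
    norm_num

theorem minError_le_geomMeanError [NormedSpace ℝ X] [IsScalarTower ℝ 𝕜 X] {n : ℕ}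
    (hn : 1 ≤ n) (S : X →L[𝕜] Y) {F : Set X} (hF : Convex ℝ F) (hb : Bornology.IsBounded F)
    (star sq : AlgClass) :
    minError.{w} star (2 * n - 1) S F
        ≤ (8192 : ℝ≥0) * (n : ℝ≥0∞) ^ (3 / 2 : ℝ) * geomMeanError.{w} sq n S F ∧
      ((∀ f ∈ F, -f ∈ F) →
        minError.{w} star (2 * n - 1) S F
          ≤ (8192 : ℝ≥0) * (n : ℝ≥0∞) * geomMeanError.{w} sq n S F) := by
  have hn0 : (0 : ℝ) < n := by exact_mod_cast hn
  obtain ⟨nf, hnf⟩ := exists_isNorming (𝕜 := 𝕜) (Y := Y)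
  have key : ∀ δ > 0, HasWidth (2 * n - 1) S F δ →
      ENNReal.ofReal (δ / (8192 * (n * √n))) ≤ geomMeanError.{w} sq n S F ∧
      ((∀ f ∈ F, -f ∈ F) →
        ENNReal.ofReal (δ / (8192 * (√n * √n))) ≤ geomMeanError.{w} sq n S F) := by
    intro δ hδ hw
    obtain ⟨B, -⟩ := exists_blockSystem hnf hw
    exact ofReal_le_geomMeanError_of_blockSystem hn hF hδ (by positivity) B
      (fun σ _ => sum_re_functional_sq_le (index_card_le 𝕜 n) B σ) sq
  constructor
  · refine minError_le_of_width hF hb hn (by norm_num) (fun δ hδ hw => ?_) star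
    rw [show (3 / 2 : ℝ) = 1 + 1 / 2 by norm_num, Real.rpow_add hn0, Real.rpow_one,
      ← Real.sqrt_eq_rpow]
    exact (key δ hδ hw).1
  · intro hs
    rw [← ENNReal.rpow_one (n : ℝ≥0∞)]
    refine minError_le_of_width hF hb hn (by norm_num) (fun δ hδ hw => ?_) star
    have := (key δ hδ hw).2 hs
    rwa [Real.mul_self_sqrt hn0.le, ← Real.rpow_one (n : ℝ)] at this

end BanachTarget

section HilbertTarget

variable {𝕜 : Type a} {X : Type b} {Y : Type c} [RCLike 𝕜]
  [NormedAddCommGroup X] [NormedSpace 𝕜 X]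
  [NormedAddCommGroup Y] [InnerProductSpace 𝕜 Y]

theorem isNorming_innerSL :
    IsNorming (fun y : Y => innerSL 𝕜 (((‖y‖⁻¹ : ℝ) : 𝕜) • y)) := by
  intro y
  rcases eq_or_ne y 0 with rfl | hy
  · simp
  · have hy' : ‖y‖ ≠ 0 := norm_ne_zero_iff.2 hy
    constructor
    · rw [innerSL_apply_norm, norm_smul, RCLike.norm_ofReal, abs_inv, abs_norm,
        inv_mul_cancel₀ hy']
    · rw [innerSL_apply_apply, inner_smul_left, inner_self_eq_norm_sq_to_K, RCLike.conj_ofReal,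
        ← RCLike.ofReal_pow, ← RCLike.ofReal_mul]
      congr 1
      field_simp

theorem sum_re_functional_sq_le_of_inner {n m : ℕ} {S : X →L[𝕜] Y} {D : Set X}
    {η : ℝ} (B : BlockSystem (2 * n) S D η) {t : Fin (2 * n) → ℝ}
    (hB : ∀ j, B.dual j = (2⁻¹ : 𝕜) • (innerSL 𝕜 (((‖S (B.fst j)‖⁻¹ : ℝ) : 𝕜) • S (B.fst j)) +
      ((t j : 𝕜) * RCLike.I) • innerSL 𝕜 (((‖S (B.snd j)‖⁻¹ : ℝ) : 𝕜) • S (B.snd j))))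
    {σ : Fin m → Fin (2 * n) × Bool} (hσ : ∀ i j, i < j → (σ i).1 < (σ j).1 ∨
        ((σ i).1 = (σ j).1 ∧ (σ i).2 = false ∧ (σ j).2 = true)) (y : Y) :
    ∑ i, RCLike.re (B.functional (σ i) y) ^ 2 ≤ ‖y‖ ^ 2 := by
  let w' : Fin (2 * n) → Y := fun j => (2⁻¹ : 𝕜) • ((((‖S (B.fst j)‖⁻¹ : ℝ) : 𝕜) • S (B.fst j)) -
      ((t j : 𝕜) * RCLike.I) • (((‖S (B.snd j)‖⁻¹ : ℝ) : 𝕜) • S (B.snd j)))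
  have hdual : ∀ j, B.dual j = innerSL 𝕜 (w' j) := fun j => by
    rw [hB]
    ext y
    simp only [w', smul_apply, add_apply, innerSL_apply_apply, inner_smul_left, inner_sub_left,
      map_mul, RCLike.conj_I, RCLike.conj_ofReal, map_inv₀, RCLike.conj_ofNat, smul_eq_mul]
    ring
  let v : Fin (2 * n) × Bool → Y := fun q => if q.2 then (RCLike.I : 𝕜) • w' q.1 else w' q.1
  have hfun : ∀ q, B.functional q = innerSL 𝕜 (v q) := fun q => by
    unfold BlockSystem.functional
    ext y
    simp only [v, hdual]
    split_ifs <;> simp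
  have hv1 : ∀ q, ‖v q‖ ≤ 1 := fun q => by
    rw [← innerSL_apply_norm 𝕜, ← hfun]
    exact B.norm_functional_le q
  have horth : ∀ p q : Fin (2 * n), p < q → inner 𝕜 (w' p) (w' q) = 0 := fun p q hpq => by
    rw [← innerSL_apply_apply 𝕜, ← hdual]
    simp [w', B.dual_fst p q hpq, B.dual_snd p q hpq]
  simp_rw [hfun, innerSL_apply_apply]
  refine sum_re_inner_sq_le (v := fun i => v (σ i)) (fun i j hij => ?_) (fun i => hv1 _) y
  rcases hσ i j hij with h | ⟨h1, h2, h3⟩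
  · simp only [v]
    split_ifs <;> simp [inner_smul_left, inner_smul_right, horth _ _ h]
  · simp only [v, h1, h2, h3, if_true, Bool.false_eq_true, if_false, inner_smul_right, inner_self_eq_norm_sq_to_K]
    rw [← RCLike.ofReal_pow]
    simp

theorem minError_le_geomMeanError_of_inner [NormedSpace ℝ X] [IsScalarTower ℝ 𝕜 X] {n : ℕ}
    (hn : 1 ≤ n) (S : X →L[𝕜] Y) {F : Set X} (hF : Convex ℝ F) (hb : Bornology.IsBounded F)
    (star sq : AlgClass) :
    minError.{w} star (2 * n - 1) S F
        ≤ (8192 : ℝ≥0) * (n : ℝ≥0∞) * geomMeanError.{w} sq n S F ∧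
      ((∀ f ∈ F, -f ∈ F) →
        minError.{w} star (2 * n - 1) S F
          ≤ (8192 : ℝ≥0) * (n : ℝ≥0∞) ^ (1 / 2 : ℝ) * geomMeanError.{w} sq n S F) := by
  have key : ∀ δ > 0, HasWidth (2 * n - 1) S F δ →
      ENNReal.ofReal (δ / (8192 * (n * 1))) ≤ geomMeanError.{w} sq n S F ∧
      ((∀ f ∈ F, -f ∈ F) →
        ENNReal.ofReal (δ / (8192 * (√n * 1))) ≤ geomMeanError.{w} sq n S F) := by
    intro δ hδ hw
    obtain ⟨B, t, hB⟩ := exists_blockSystem (isNorming_innerSL (𝕜 := 𝕜) (Y := Y)) hw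
    refine ofReal_le_geomMeanError_of_blockSystem hn hF hδ one_pos B (fun σ hσ y => ?_) sq
    refine (sum_re_functional_sq_le_of_inner B (fun j => (hB j).2) hσ y).trans ?_
    nlinarith [sq_nonneg ‖y‖]
  simp only [mul_one] at key
  constructor
  · rw [← ENNReal.rpow_one (n : ℝ≥0∞)]
    refine minError_le_of_width hF hb hn (by norm_num) (fun δ hδ hw => ?_) star
    rw [Real.rpow_one]
    exact (key δ hδ hw).1
  · intro hs
    refine minError_le_of_width hF hb hn (by norm_num) (fun δ hδ hw => ?_) star
    rw [← Real.sqrt_eq_rpow]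
    exact (key δ hδ hw).2 hs

end HilbertTarget

section HilbertSource

variable {𝕜 : Type a} {X : Type b} {Y : Type c} [RCLike 𝕜]
  [NormedAddCommGroup X] [InnerProductSpace 𝕜 X]
  [NormedAddCommGroup Y] [NormedSpace 𝕜 Y]

theorem exists_blockSystem_of_inner {S : X →L[𝕜] Y} {δ : ℝ} (hδ : 0 < δ) {p N : ℕ}
    (hN : 2 * (N - 1) ≤ p) (hw : HasWidth p S (Metric.closedBall (0 : X) 1) δ) :
    ∃ B : BlockSystem N S (Metric.closedBall (0 : X) 2) (δ / 2),
      (∀ i j, i < j → inner 𝕜 (B.fst i) (B.fst j) = 0) ∧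
      ∀ j, B.snd j = (RCLike.I : 𝕜) • B.fst j := by
  obtain ⟨nf, hnf⟩ := exists_isNorming (𝕜 := 𝕜) (Y := Y)
  obtain ⟨f, hP, hr⟩ := exists_fin_seq (fun _ (x : X) => ‖x‖ ≤ 2 ∧ δ ≤ ‖S x‖)
    (fun x x' => nf (S x) (S x') = 0 ∧ inner 𝕜 x x' = 0) N (by
      intro k hk f _
      obtain ⟨x, hx, hLx, hSx⟩ := hw.exists_of_card_le (ι := Fin k ⊕ Fin k) (by simp; omega)
        (Sum.elim (fun i => (nf (S (f i))).comp S) fun i => innerSL 𝕜 (f i))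
      refine ⟨x, ⟨?_, hSx⟩, fun i => ⟨hLx (Sum.inl i), hLx (Sum.inr i)⟩⟩
      obtain ⟨g, hg, h, hh, rfl⟩ := hx
      have h1 := norm_sub_le g h
      simp only [Metric.mem_closedBall, dist_zero_right] at hg hh
      exact h1.trans (by linarith))
  have hsnd : ∀ j, nf (S (f j)) (S ((RCLike.I : 𝕜) • f j)) = RCLike.I * (‖S (f j)‖ : 𝕜) :=
    fun j => by rw [map_smul, map_smul, (hnf _).2, smul_eq_mul]
  refine ⟨⟨f, fun j => (RCLike.I : 𝕜) • f j, fun j => nf (S (f j)), fun j => by simpa using (hP j).1,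
    fun j => ?_, fun j => (hnf _).1, fun i j hij => (hr i j hij).1, fun i j hij => ?_,
    fun j => ?_, fun j _ => ?_, fun j _ hI => ?_⟩, fun i j hij => (hr i j hij).2, fun j => rfl⟩
  · simp only [Metric.mem_closedBall, dist_zero_right, norm_smul]
    exact (mul_le_of_le_one_left (norm_nonneg _) norm_I_le_one).trans (hP j).1
  · rw [map_smul, map_smul, (hr i j hij).1, smul_zero]
  · rw [(hnf _).2, RCLike.ofReal_re]
    linarith [(hP j).2]
  · rw [hsnd]
    simp
  · rw [hsnd, RCLike.im_mul_ofReal, hI, one_mul, abs_norm]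
    linarith [(hP j).2]

theorem minError_closedBall_le_geomMeanError [NormedSpace ℝ X] [IsScalarTower ℝ 𝕜 X] {n : ℕ}
    (hn : 1 ≤ n) (S : X →L[𝕜] Y) (star sq : AlgClass) :
    minError.{w} star (4 * n - 1) S (Metric.closedBall (0 : X) 1)
      ≤ (8192 : ℝ≥0) * (n : ℝ≥0∞) ^ (1 / 2 : ℝ)
        * geomMeanError.{w} sq n S (Metric.closedBall (0 : X) 1) := by
  have hn0 : (0 : ℝ) < n := by exact_mod_cast hn
  have hF : Convex ℝ (Metric.closedBall (0 : X) 1) := convex_closedBall 0 1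
  refine minError_le_of_width hF Metric.isBounded_closedBall hn (by norm_num)
    (fun δ hδ hw => ?_) star
  obtain ⟨B, horth, hsnd⟩ := exists_blockSystem_of_inner hδ (N := 2 * n) (by omega) hw
  obtain ⟨σ, hσ, hσ'⟩ := exists_index 𝕜 hn
  have hz : ∀ u : EuclideanSpace ℝ (Fin (2 * realDim 𝕜 * n - (realDim 𝕜 - 1))), ‖u‖ ≤ 1 →
      0 + (1 / 8 : ℝ) • ∑ i, u i • B.vec (σ i) ∈ Metric.closedBall (0 : X) 1 := by
    intro u hu
    have hv : ∀ i j, i < j → RCLike.re (inner 𝕜 (B.vec (σ i)) (B.vec (σ j))) = 0 := by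
      intro i j hij
      rcases hσ i j hij with h | ⟨h1, h2, h3⟩
      · unfold BlockSystem.vec
        split_ifs <;> simp [hsnd, inner_smul_left, inner_smul_right, horth _ _ h]
      · simp only [BlockSystem.vec, h1, h2, h3, if_true, Bool.false_eq_true, if_false, hsnd, inner_smul_right,
          inner_self_eq_norm_sq_to_K]
        rw [← RCLike.ofReal_pow]
        simp
    have h1 : ‖∑ i, u i • B.vec (σ i)‖ ^ 2 ≤ 2 ^ 2 := by
      simp_rw [RCLike.real_smul_eq_coe_smul (K := 𝕜)]
      rw [norm_sq_sum_of_re_inner_eq_zero hv]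
      calc ∑ i, u i ^ 2 * ‖B.vec (σ i)‖ ^ 2 ≤ ∑ i, u i ^ 2 * 2 ^ 2 := by
            refine Finset.sum_le_sum fun i _ => mul_le_mul_of_nonneg_left ?_ (sq_nonneg _)
            exact pow_le_pow_left₀ (norm_nonneg _) (by simpa using B.vec_mem (σ i)) 2
        _ = ‖u‖ ^ 2 * 2 ^ 2 := by rw [← Finset.sum_mul, EuclideanSpace.real_norm_sq_eq]
        _ ≤ 2 ^ 2 := mul_le_of_le_one_left (by norm_num) (pow_le_one₀ (norm_nonneg _) hu)
    have h2 := le_of_sq_le_sq h1 (by norm_num)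
    rw [zero_add, mem_closedBall_zero_iff, norm_smul, Real.norm_of_nonneg (by norm_num)]
    linarith
  have := B.ofReal_le_geomMeanError.{w} hF hn (by positivity) (by positivity) (by positivity)
    hσ hσ' (sum_re_functional_sq_le (index_card_le 𝕜 n) B σ) hz sq
  rw [← Real.sqrt_eq_rpow]
  convert this using 2
  field_simp
  norm_num

end HilbertSource

theorem mainTheorem9 :
    ∃ C : ℝ≥0, ∀ (star sq : AlgClass) (n : ℕ), 1 ≤ n → ∀ (𝕜 : Type a) [RCLike 𝕜],
      -- `X` and `Y` Banach spaces, without and with symmetry of `F`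
      (∀ (X : Type b) [NormedAddCommGroup X] [NormedSpace 𝕜 X] [NormedSpace ℝ X]
          [IsScalarTower ℝ 𝕜 X] [CompleteSpace X]
          (Y : Type c) [NormedAddCommGroup Y] [NormedSpace 𝕜 Y] [CompleteSpace Y]
          (S : X →L[𝕜] Y) (F : Set X), Convex ℝ F → Bornology.IsBounded F →
        minError.{w} star (2 * n - 1) S F
            ≤ C * (n : ℝ≥0∞) ^ (3 / 2 : ℝ) * geomMeanError.{w} sq n S F ∧
        ((∀ f ∈ F, -f ∈ F) →
          minError.{w} star (2 * n - 1) S F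
            ≤ C * (n : ℝ≥0∞) * geomMeanError.{w} sq n S F)) ∧
      -- `Y` a Hilbert space, without and with symmetry of `F`
      (∀ (X : Type b) [NormedAddCommGroup X] [NormedSpace 𝕜 X] [NormedSpace ℝ X]
          [IsScalarTower ℝ 𝕜 X] [CompleteSpace X]
          (Y : Type c) [NormedAddCommGroup Y] [InnerProductSpace 𝕜 Y] [CompleteSpace Y]
          (S : X →L[𝕜] Y) (F : Set X), Convex ℝ F → Bornology.IsBounded F →
        minError.{w} star (2 * n - 1) S F
            ≤ C * (n : ℝ≥0∞) * geomMeanError.{w} sq n S F ∧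
        ((∀ f ∈ F, -f ∈ F) →
          minError.{w} star (2 * n - 1) S F
            ≤ C * (n : ℝ≥0∞) ^ (1 / 2 : ℝ) * geomMeanError.{w} sq n S F)) ∧
      -- `X` a Hilbert space and `F` its unit ball
      (∀ (X : Type b) [NormedAddCommGroup X] [InnerProductSpace 𝕜 X] [NormedSpace ℝ X]
          [IsScalarTower ℝ 𝕜 X] [CompleteSpace X]
          (Y : Type c) [NormedAddCommGroup Y] [NormedSpace 𝕜 Y] [CompleteSpace Y]
          (S : X →L[𝕜] Y),
        minError.{w} star (4 * n - 1) S (Metric.closedBall (0 : X) 1)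
            ≤ C * (n : ℝ≥0∞) ^ (1 / 2 : ℝ)
              * geomMeanError.{w} sq n S (Metric.closedBall (0 : X) 1)) := by
  refine ⟨8192, fun star sq n hn 𝕜 _ => ⟨?_, ?_, ?_⟩⟩
  · intro X _ _ _ _ _ Y _ _ _ S F hF hb
    exact minError_le_geomMeanError hn S hF hb star sq
  · intro X _ _ _ _ _ Y _ _ _ S F hF hb
    exact minError_le_geomMeanError_of_inner hn S hF hb star sq
  · intro X _ _ _ _ _ Y _ _ _ S
    exact minError_closedBall_le_geomMeanError hn S star sq
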